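/- Let $C$ be a smooth projective (irreducible) curve over $\mathbb{C}$ with an involution $\sigma\neq \mathrm{id}$, let $\pi: C\to B=C/\sigma$ be the quotient map, and let $R\subset C$ be the (finite, possibly empty) set of fixed points of $\sigma$. Let $\mathrm{Pic}(C)^\sigma$ be the group of isomorphism classes of line bundles $L$ on $C$ with $\sigma^*L\cong L$; it contains $\pi^*\mathrm{Pic}(B)$. Let $\varphi:\mathbb{Z}^R\to \mathrm{Pic}(C)$ be the homomorphism which maps $r\in R$ to the class of $\mathcal{O}_C(r)$; its image lies in $\mathrm{Pic}(C)^\sigma$. Then $\varphi$ induces a surjective homomorphism $$\bar\varphi:(\mathbb{Z}/2)^R\longrightarrow \mathrm{Pic}(C)^\sigma/\pi^*\mathrm{Pic}(B),$$ whose kernel is $\mathbb{Z}/2\cdot(1,\ldots,1)$. -/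

import Mathlib

open CategoryTheory AlgebraicGeometry TopologicalSpace Opposite

universe u

namespace CurveInvolution

/-! ### Line bundles and the Picard group of a scheme -/

section Units

variable {X Y Z : Scheme.{u}}

/-- Pullback of invertible functions along `f`, from an open `U` of `Y` to an open `V ⊆ f⁻¹ U`
of `X`. -/
noncomputable def pullUnits (f : X ⟶ Y) {U : Y.Opens} {V : X.Opens} (h : V ≤ f ⁻¹ᵁ U) :
    Γ(Y, U)ˣ →* Γ(X, V)ˣ :=
  Units.map (f.appLE U V h).hom.toMonoidHom

/-- Restriction of invertible functions from an open `U` to a smaller open `V`. -/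
noncomputable def resUnits {U V : X.Opens} (h : V ≤ U) : Γ(X, U)ˣ →* Γ(X, V)ˣ :=
  Units.map (X.presheaf.map (homOfLE h).op).hom.toMonoidHom

theorem resUnits_resUnits {U V W : X.Opens} (h : V ≤ U) (k : W ≤ V) (s : Γ(X, U)ˣ) :
    resUnits k (resUnits h s) = resUnits (k.trans h) s := by
  ext
  change (X.presheaf.map (homOfLE k).op).hom ((X.presheaf.map (homOfLE h).op).hom s.val) =
    (X.presheaf.map (homOfLE (k.trans h)).op).hom s.val
  rw [← CommRingCat.comp_apply, ← Functor.map_comp]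
  rfl

theorem resUnits_pullUnits (f : X ⟶ Y) {U : Y.Opens} {V W : X.Opens} (h : V ≤ f ⁻¹ᵁ U)
    (k : W ≤ V) (s : Γ(Y, U)ˣ) :
    resUnits k (pullUnits f h s) = pullUnits f (k.trans h) s := by
  ext
  change (X.presheaf.map (homOfLE k).op).hom ((f.appLE U V h).hom s.val) =
    (f.appLE U W (k.trans h)).hom s.val
  rw [← CommRingCat.comp_apply, Scheme.Hom.appLE_map]

theorem pullUnits_resUnits (f : X ⟶ Y) {U U' : Y.Opens} {V : X.Opens} (h : V ≤ f ⁻¹ᵁ U')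
    (k : U' ≤ U) (s : Γ(Y, U)ˣ) :
    pullUnits f h (resUnits k s) = pullUnits f (h.trans (f.preimage_mono k)) s := by
  ext
  change (f.appLE U' V h).hom ((Y.presheaf.map (homOfLE k).op).hom s.val) =
    (f.appLE U V (h.trans (f.preimage_mono k))).hom s.val
  rw [← CommRingCat.comp_apply, Scheme.Hom.map_appLE]

end Units

/-- A line bundle on `X`, given by transition functions: every point `x` comes with a trivializing
open neighbourhood `nhd x`, and over `nhd x ∩ nhd y` the two trivializations differ by the
invertible function `trans x y`. A section is a family of functions `s x` on `nhd x` with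
`s x = trans x y * s y` on the overlaps. -/
structure LineBundle (X : Scheme.{u}) where
  nhd : X → X.Opens
  mem_nhd : ∀ x, x ∈ nhd x
  trans : ∀ x y, Γ(X, nhd x ⊓ nhd y)ˣ
  cocycle : ∀ x y z,
    resUnits (V := nhd x ⊓ nhd y ⊓ nhd z) inf_le_left (trans x y) *
      resUnits (le_inf (inf_le_left.trans inf_le_right) inf_le_right) (trans y z) =
      resUnits (le_inf (inf_le_left.trans inf_le_left) inf_le_right) (trans x z)

namespace LineBundle

variable {X Y : Scheme.{u}}

/-- Transition function of `L` restricted to a smaller open. -/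
noncomputable def transOn (L : LineBundle X) (x y : X) {W : X.Opens}
    (h : W ≤ L.nhd x ⊓ L.nhd y) : Γ(X, W)ˣ :=
  resUnits h (L.trans x y)

/-- `L` and `M` are isomorphic: over suitable smaller neighbourhoods `W x` of the points, an
isomorphism from `M` to `L` is multiplication by an invertible function `a x` in the given
trivializations, compatibly with the transition functions. -/
def Isomorphic (L M : LineBundle X) : Prop :=
  ∃ (W : X → X.Opens) (_ : ∀ x, x ∈ W x) (hL : ∀ x, W x ≤ L.nhd x) (hM : ∀ x, W x ≤ M.nhd x)
    (a : ∀ x, Γ(X, W x)ˣ), ∀ x y,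
      L.transOn x y (inf_le_inf (hL x) (hL y)) * resUnits inf_le_right (a y) =
        resUnits inf_le_left (a x) * M.transOn x y (inf_le_inf (hM x) (hM y))

theorem Isomorphic.refl (L : LineBundle X) : L.Isomorphic L :=
  ⟨L.nhd, L.mem_nhd, fun _ => le_rfl, fun _ => le_rfl, fun _ => 1, by simp⟩

theorem Isomorphic.symm {L M : LineBundle X} : L.Isomorphic M → M.Isomorphic L := by
  rintro ⟨W, hW, hL, hM, a, ha⟩
  refine ⟨W, hW, hM, hL, fun x => (a x)⁻¹, fun x y => ?_⟩
  have := ha x y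
  simp only [map_inv]
  rw [mul_inv_eq_iff_eq_mul, mul_assoc, this, inv_mul_cancel_left]

/-- Compatibility of an isomorphism with the transition functions, on a smaller open. -/
theorem transOn_res {L : LineBundle X} {x y : X} {W W' : X.Opens}
    (h : W ≤ L.nhd x ⊓ L.nhd y) (k : W' ≤ W) :
    resUnits k (L.transOn x y h) = L.transOn x y (k.trans h) :=
  resUnits_resUnits _ _ _

theorem Isomorphic.trans {L M N : LineBundle X} : L.Isomorphic M → M.Isomorphic N → L.Isomorphic N := by
  rintro ⟨W, hW, hL, hM, a, ha⟩ ⟨W', hW', hM', hN, b, hb⟩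
  refine ⟨fun x => W x ⊓ W' x, fun x => ⟨hW x, hW' x⟩, fun x => inf_le_left.trans (hL x),
    fun x => inf_le_right.trans (hN x),
    fun x => resUnits inf_le_left (a x) * resUnits inf_le_right (b x), fun x y => ?_⟩
  have h1 := congrArg (resUnits (inf_le_inf (inf_le_left : W x ⊓ W' x ≤ W x)
    (inf_le_left : W y ⊓ W' y ≤ W y))) (ha x y)
  have h2 := congrArg (resUnits (inf_le_inf (inf_le_right : W x ⊓ W' x ≤ W' x)
    (inf_le_right : W y ⊓ W' y ≤ W' y))) (hb x y)
  simp only [map_mul, resUnits_resUnits, transOn_res] at h1 h2 ⊢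
  rw [← mul_assoc, h1, mul_assoc, h2, mul_assoc]

instance setoid (X : Scheme.{u}) : Setoid (LineBundle X) where
  r := Isomorphic
  iseqv := ⟨Isomorphic.refl, Isomorphic.symm, Isomorphic.trans⟩

/-- The trivial line bundle `𝒪_X`. -/
def trivial (X : Scheme.{u}) : LineBundle X where
  nhd _ := ⊤
  mem_nhd _ := _root_.trivial
  trans _ _ := 1
  cocycle := by simp

/-- The tensor product of two line bundles. -/
noncomputable def tensor (L M : LineBundle X) : LineBundle X where
  nhd x := L.nhd x ⊓ M.nhd x
  mem_nhd x := ⟨L.mem_nhd x, M.mem_nhd x⟩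
  trans x y := L.transOn x y (inf_le_inf inf_le_left inf_le_left) *
    M.transOn x y (inf_le_inf inf_le_right inf_le_right)
  cocycle x y z := by
    have h1 := congrArg (resUnits (inf_le_inf (inf_le_inf
      (inf_le_left : L.nhd x ⊓ M.nhd x ≤ _) (inf_le_left : L.nhd y ⊓ M.nhd y ≤ _))
      (inf_le_left : L.nhd z ⊓ M.nhd z ≤ _))) (L.cocycle x y z)
    have h2 := congrArg (resUnits (inf_le_inf (inf_le_inf
      (inf_le_right : L.nhd x ⊓ M.nhd x ≤ _) (inf_le_right : L.nhd y ⊓ M.nhd y ≤ _))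
      (inf_le_right : L.nhd z ⊓ M.nhd z ≤ _))) (M.cocycle x y z)
    simp only [map_mul, resUnits_resUnits, transOn] at h1 h2 ⊢
    rw [← h1, ← h2, mul_mul_mul_comm]

/-- The dual of a line bundle. -/
noncomputable def dual (L : LineBundle X) : LineBundle X where
  nhd := L.nhd
  mem_nhd := L.mem_nhd
  trans x y := (L.trans x y)⁻¹
  cocycle x y z := by
    simp only [map_inv]
    rw [← L.cocycle x y z, mul_inv]

/-- The pullback of a line bundle along `f : X ⟶ Y`. -/
noncomputable def pullback (f : X ⟶ Y) (L : LineBundle Y) : LineBundle X where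
  nhd x := f ⁻¹ᵁ L.nhd (f x)
  mem_nhd x := L.mem_nhd (f x)
  trans x y := pullUnits f (U := L.nhd (f x) ⊓ L.nhd (f y)) (fun _ h => h)
    (L.trans (f x) (f y))
  cocycle x y z := by
    have key : ∀ (W : X.Opens) (U U' : Y.Opens) (h : W ≤ f ⁻¹ᵁ U') (k : U' ≤ U) (V : X.Opens)
        (h' : V ≤ f ⁻¹ᵁ U) (k' : W ≤ V) (s : Γ(Y, U)ˣ),
        resUnits k' (pullUnits f h' s) = pullUnits f h (resUnits k s) := fun W U U' h k V h' k' s =>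
      (resUnits_pullUnits f h' k' s).trans (pullUnits_resUnits f h k s).symm
    have h1 := congrArg (pullUnits f (U := L.nhd (f x) ⊓ L.nhd (f y) ⊓ L.nhd (f z))
      (V := f ⁻¹ᵁ L.nhd (f x) ⊓ f ⁻¹ᵁ L.nhd (f y) ⊓
      f ⁻¹ᵁ L.nhd (f z)) (fun _ h => h)) (L.cocycle (f x) (f y) (f z))
    refine (congrArg₂ (· * ·) (key _ _ _ _ _ _ _ _ _) (key _ _ _ _ _ _ _ _ _)).trans
      ((((map_mul _ _ _).symm.trans h1)).trans (key _ _ _ _ _ _ _ _ _).symm)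

theorem transOn_tensor (L M : LineBundle X) (x y : X) {W : X.Opens}
    (h : W ≤ (L.tensor M).nhd x ⊓ (L.tensor M).nhd y) :
    (L.tensor M).transOn x y h =
      L.transOn x y (h.trans (inf_le_inf inf_le_left inf_le_left)) *
      M.transOn x y (h.trans (inf_le_inf inf_le_right inf_le_right)) :=
  (map_mul (resUnits h) _ _).trans
    (congrArg₂ (· * ·) (resUnits_resUnits _ _ _) (resUnits_resUnits _ _ _))

theorem transOn_dual (L : LineBundle X) (x y : X) {W : X.Opens}
    (h : W ≤ L.dual.nhd x ⊓ L.dual.nhd y) :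
    L.dual.transOn x y h = (L.transOn x y (W := W) h)⁻¹ :=
  map_inv (resUnits (U := L.nhd x ⊓ L.nhd y) h) _

theorem transOn_trivial (x y : X) {W : X.Opens}
    (h : W ≤ (trivial X).nhd x ⊓ (trivial X).nhd y) :
    (trivial X).transOn x y h = 1 :=
  map_one (resUnits h)

theorem transOn_pullback (f : X ⟶ Y) (L : LineBundle Y) (x y : X) {W : X.Opens}
    (h : W ≤ (L.pullback f).nhd x ⊓ (L.pullback f).nhd y) :
    (L.pullback f).transOn x y h =
      pullUnits f (U := L.nhd (f x) ⊓ L.nhd (f y)) h (L.trans (f x) (f y)) :=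
  resUnits_pullUnits f (U := L.nhd (f x) ⊓ L.nhd (f y)) _ _ _

theorem Isomorphic.tensor {L L' M M' : LineBundle X} :
    L.Isomorphic L' → M.Isomorphic M' → (L.tensor M).Isomorphic (L'.tensor M') := by
  rintro ⟨W, hW, hL, hL', a, ha⟩ ⟨V, hV, hM, hM', b, hb⟩
  refine ⟨fun x => W x ⊓ V x, fun x => ⟨hW x, hV x⟩, fun x => inf_le_inf (hL x) (hM x),
    fun x => inf_le_inf (hL' x) (hM' x),
    fun x => resUnits inf_le_left (a x) * resUnits inf_le_right (b x), fun x y => ?_⟩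
  have h1 := congrArg (resUnits (inf_le_inf (inf_le_left : W x ⊓ V x ≤ W x)
    (inf_le_left : W y ⊓ V y ≤ W y))) (ha x y)
  have h2 := congrArg (resUnits (inf_le_inf (inf_le_right : W x ⊓ V x ≤ V x)
    (inf_le_right : W y ⊓ V y ≤ V y))) (hb x y)
  simp only [map_mul, resUnits_resUnits, transOn_res] at h1 h2
  rw [transOn_tensor, transOn_tensor]
  simp only [map_mul, resUnits_resUnits]
  rw [mul_mul_mul_comm, h1, h2, mul_mul_mul_comm]

theorem Isomorphic.dual {L L' : LineBundle X} : L.Isomorphic L' → L.dual.Isomorphic L'.dual := by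
  rintro ⟨W, hW, hL, hL', a, ha⟩
  refine ⟨W, hW, hL, hL', fun x => (a x)⁻¹, fun x y => ?_⟩
  have h1 := ha x y
  rw [transOn_dual, transOn_dual]
  simp only [map_inv]
  rw [← mul_inv, h1, mul_inv]

theorem Isomorphic.pullback (f : X ⟶ Y) {L L' : LineBundle Y} :
    L.Isomorphic L' → (L.pullback f).Isomorphic (L'.pullback f) := by
  rintro ⟨W, hW, hL, hL', a, ha⟩
  refine ⟨fun x => f ⁻¹ᵁ W (f x), fun x => hW (f x), fun x => f.preimage_mono (hL (f x)),
    fun x => f.preimage_mono (hL' (f x)), fun x => pullUnits f le_rfl (a (f x)), fun x y => ?_⟩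
  have h1 := congrArg (pullUnits f (U := W (f x) ⊓ W (f y))
    (V := f ⁻¹ᵁ W (f x) ⊓ f ⁻¹ᵁ W (f y)) (fun _ h => h)) (ha (f x) (f y))
  rw [transOn_pullback, transOn_pullback, resUnits_pullUnits, resUnits_pullUnits]
  have h2 := (map_mul _ _ _).symm.trans (h1.trans (map_mul _ _ _))
  simp only [transOn] at h2
  exact (congrArg₂ (· * ·) (pullUnits_resUnits f _ _ _) (pullUnits_resUnits f _ _ _)).symm.trans
    (h2.trans (congrArg₂ (· * ·) (pullUnits_resUnits f _ _ _) (pullUnits_resUnits f _ _ _)))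

end LineBundle

/-- The Picard group of `X`: isomorphism classes of line bundles, with the tensor product as group
law (written additively). -/
def Pic (X : Scheme.{u}) : Type u := Quotient (LineBundle.setoid X)

namespace Pic

variable {X Y : Scheme.{u}}

/-- The isomorphism class of a line bundle. -/
def mk (L : LineBundle X) : Pic X := Quotient.mk _ L

/-- Two line bundles whose transition functions agree wherever both are defined are isomorphic. -/
theorem mk_eq_of_transOn {L M : LineBundle X}
    (h : ∀ x y (W : X.Opens) (hL : W ≤ L.nhd x ⊓ L.nhd y) (hM : W ≤ M.nhd x ⊓ M.nhd y),
      L.transOn x y hL = M.transOn x y hM) : mk L = mk M :=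
  Quotient.sound ⟨fun x => L.nhd x ⊓ M.nhd x, fun x => ⟨L.mem_nhd x, M.mem_nhd x⟩,
    fun _ => inf_le_left, fun _ => inf_le_right, fun _ => 1, fun x y => by
      simp only [map_one, one_mul, mul_one]; exact h _ _ _ _ _⟩

noncomputable instance : Add (Pic X) :=
  ⟨Quotient.map₂ LineBundle.tensor fun _ _ h _ _ k => h.tensor k⟩

instance : Zero (Pic X) := ⟨mk (LineBundle.trivial X)⟩

noncomputable instance : Neg (Pic X) := ⟨Quotient.map LineBundle.dual fun _ _ h => h.dual⟩

noncomputable instance : AddCommGroup (Pic X) where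
  nsmul := nsmulRec
  zsmul := zsmulRec
  add_assoc := by
    rintro ⟨L⟩ ⟨M⟩ ⟨N⟩
    refine mk_eq_of_transOn (L := (L.tensor M).tensor N) (M := L.tensor (M.tensor N))
      fun x y W h k => ?_
    simp only [LineBundle.transOn_tensor, mul_assoc]
  zero_add := by
    rintro ⟨L⟩
    refine mk_eq_of_transOn (L := (LineBundle.trivial X).tensor L) (M := L) fun x y W h k => ?_
    simp only [LineBundle.transOn_tensor, LineBundle.transOn_trivial, one_mul]
  add_zero := by
    rintro ⟨L⟩
    refine mk_eq_of_transOn (L := L.tensor (LineBundle.trivial X)) (M := L) fun x y W h k => ?_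
    simp only [LineBundle.transOn_tensor, LineBundle.transOn_trivial, mul_one]
  neg_add_cancel := by
    rintro ⟨L⟩
    refine mk_eq_of_transOn (L := L.dual.tensor L) (M := LineBundle.trivial X)
      fun x y W h k => ?_
    rw [LineBundle.transOn_tensor, LineBundle.transOn_trivial, LineBundle.transOn_dual]
    exact inv_mul_cancel _
  add_comm := by
    rintro ⟨L⟩ ⟨M⟩
    refine mk_eq_of_transOn (L := L.tensor M) (M := M.tensor L) fun x y W h k => ?_
    simp only [LineBundle.transOn_tensor]
    exact mul_comm _ _

/-- The pullback homomorphism `f^* : Pic Y → Pic X`. -/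
noncomputable def pullback (f : X ⟶ Y) : Pic Y →+ Pic X :=
  AddMonoidHom.mk' (Quotient.map (LineBundle.pullback f) fun _ _ h => h.pullback f) <| by
    rintro ⟨L⟩ ⟨M⟩
    refine mk_eq_of_transOn (L := (L.tensor M).pullback f)
      (M := (L.pullback f).tensor (M.pullback f)) fun x y W h k => ?_
    rw [LineBundle.transOn_tensor, LineBundle.transOn_pullback, LineBundle.transOn_pullback,
      LineBundle.transOn_pullback]
    exact (map_mul (pullUnits f _) _ _).trans
      (congrArg₂ (· * ·) (pullUnits_resUnits f _ _ _) (pullUnits_resUnits f _ _ _))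

end Pic

/-! ### The line bundle of a closed point -/

section Points

variable {X : Scheme.{u}}

/-- `f` is a local equation on `U` of the closed point `r` (with multiplicity one): it is
invertible at every point of `U` other than `r`, and generates the maximal ideal of the local
ring at `r` if `r ∈ U`. -/
structure IsLocalEquation (r : X) (U : X.Opens) (f : Γ(X, U)) : Prop where
  isUnit : ∀ (z : X) (hz : z ∈ U), z ≠ r → IsUnit (X.presheaf.germ U z hz f)
  span_eq : ∀ hr : r ∈ U,
    Ideal.span {X.presheaf.germ U r hr f} = IsLocalRing.maximalIdeal (X.presheaf.stalk r)

/-- A section which is a multiple of `b` in every stalk is a multiple of `b`. -/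
theorem exists_eq_mul_of_germ [IsIntegral X] {W : X.Opens} (a b : Γ(X, W))
    (hb : ∀ (z : X) (hz : z ∈ W), X.presheaf.germ W z hz b ≠ 0)
    (hab : ∀ (z : X) (hz : z ∈ W), X.presheaf.germ W z hz b ∣ X.presheaf.germ W z hz a) :
    ∃ u : Γ(X, W), a = u * b := by
  have loc : ∀ z : W, ∃ (V : X.Opens) (_ : (z : X) ∈ V) (h : V ≤ W) (v : Γ(X, V)),
      X.presheaf.map (homOfLE h).op a = v * X.presheaf.map (homOfLE h).op b := by
    rintro ⟨z, hz⟩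
    obtain ⟨c, hc⟩ := hab z hz
    obtain ⟨V, hzV, v, rfl⟩ := X.presheaf.exists_germ_eq c
    have hm : z ∈ V ⊓ W := ⟨hzV, hz⟩
    have e : X.presheaf.germ (V ⊓ W) z hm (X.presheaf.map (homOfLE inf_le_right).op a) =
        X.presheaf.germ (V ⊓ W) z hm (X.presheaf.map (homOfLE inf_le_left).op v *
          X.presheaf.map (homOfLE inf_le_right).op b) := by
      rw [map_mul, TopCat.Presheaf.germ_res_apply, TopCat.Presheaf.germ_res_apply,
        TopCat.Presheaf.germ_res_apply, hc, mul_comm]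
    have e' := germ_injective_of_isIntegral X z _ e
    exact ⟨V ⊓ W, hm, inf_le_right, _, e'⟩
  choose V hV hVW v hv using loc
  have hcomp : TopCat.Presheaf.IsCompatible X.presheaf V v := by
    intro i j
    refine TopCat.Presheaf.section_ext X.sheaf _ _ _ fun z hz => ?_
    have hzi : z ∈ V i := (inf_le_left : V i ⊓ V j ≤ V i) hz
    have hzj : z ∈ V j := (inf_le_right : V i ⊓ V j ≤ V j) hz
    have hi := congrArg (X.presheaf.germ (V i) z hzi) (hv i)
    have hj := congrArg (X.presheaf.germ (V j) z hzj) (hv j)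
    rw [map_mul, TopCat.Presheaf.germ_res_apply, TopCat.Presheaf.germ_res_apply] at hi hj
    refine (TopCat.Presheaf.germ_res_apply _ _ _ _ _).trans
      (Eq.trans ?_ (TopCat.Presheaf.germ_res_apply _ _ _ _ _).symm)
    exact mul_right_cancel₀ (M₀ := X.presheaf.stalk z) (hb z (hVW i hzi)) (hi.symm.trans hj)
  obtain ⟨u, hu, -⟩ := X.sheaf.existsUnique_gluing' V W (fun i => homOfLE (hVW i))
    (fun z hz => Opens.mem_iSup.mpr ⟨⟨z, hz⟩, hV _⟩) v hcomp
  refine ⟨u, X.sheaf.eq_of_locally_eq' V W (fun i => homOfLE (hVW i))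
    (fun z hz => Opens.mem_iSup.mpr ⟨⟨z, hz⟩, hV _⟩) _ _ fun i => ?_⟩
  refine (hv i).trans ?_
  refine ((map_mul (X.presheaf.map (homOfLE (hVW i)).op).hom u b).trans ?_).symm
  exact congrArg (· * _) (hu i)

theorem IsLocalEquation.germ_ne_zero [IsIntegral X] {r : X}
    (hr : IsLocalRing.maximalIdeal (X.presheaf.stalk r) ≠ ⊥) {U : X.Opens} {f : Γ(X, U)}
    (hf : IsLocalEquation r U f) (z : X) (hz : z ∈ U) : X.presheaf.germ U z hz f ≠ 0 := by
  by_cases h : z = r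
  · subst h
    intro h0
    apply hr
    rw [← hf.span_eq hz, h0, Ideal.span_singleton_zero]
  · exact (hf.isUnit z hz h).ne_zero

theorem IsLocalEquation.germ_dvd {r : X} {U V : X.Opens} {f : Γ(X, U)} {g : Γ(X, V)}
    (hf : IsLocalEquation r U f) (hg : IsLocalEquation r V g) (z : X) (hz : z ∈ U) (hz' : z ∈ V) :
    X.presheaf.germ V z hz' g ∣ X.presheaf.germ U z hz f := by
  by_cases h : z = r
  · subst h
    rw [← Ideal.span_singleton_le_span_singleton, hf.span_eq, hg.span_eq]
  · exact (hg.isUnit z hz' h).dvd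

/-- Two local equations of the same point differ by an invertible function. -/
theorem IsLocalEquation.exists_unit [IsIntegral X] {r : X}
    (hr : IsLocalRing.maximalIdeal (X.presheaf.stalk r) ≠ ⊥) {U V : X.Opens} {f : Γ(X, U)}
    {g : Γ(X, V)} (hf : IsLocalEquation r U f) (hg : IsLocalEquation r V g) :
    ∃ u : Γ(X, U ⊓ V)ˣ, X.presheaf.map (homOfLE (inf_le_left : U ⊓ V ≤ U)).op f =
      u * X.presheaf.map (homOfLE (inf_le_right : U ⊓ V ≤ V)).op g := by
  obtain ⟨u, hu⟩ := exists_eq_mul_of_germ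
    (X.presheaf.map (homOfLE (inf_le_left : U ⊓ V ≤ U)).op f)
    (X.presheaf.map (homOfLE (inf_le_right : U ⊓ V ≤ V)).op g)
    (fun z hz => by rw [TopCat.Presheaf.germ_res_apply]; exact hg.germ_ne_zero hr z _)
    (fun z hz => by
      rw [TopCat.Presheaf.germ_res_apply, TopCat.Presheaf.germ_res_apply]
      exact hf.germ_dvd hg z _ _)
  have hunit : IsUnit u := by
    refine X.toRingedSpace.isUnit_of_isUnit_germ (U ⊓ V) u fun z hz => ?_
    have h1 := congrArg (X.presheaf.germ (U ⊓ V) z hz) hu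
    rw [map_mul, TopCat.Presheaf.germ_res_apply, TopCat.Presheaf.germ_res_apply] at h1
    obtain ⟨c, hc⟩ := hg.germ_dvd hf z hz.2 hz.1
    refine IsUnit.of_mul_eq_one c ?_
    refine mul_right_cancel₀ (hg.germ_ne_zero hr z hz.2) ?_
    rw [one_mul, mul_right_comm]
    exact (congrArg (· * c) h1.symm).trans hc.symm
  exact ⟨hunit.unit, hu⟩

/-- A system of local equations of the point `r`, one around each point of `X`. -/
structure LocalEquations (r : X) where
  nhd : X → X.Opens
  mem_nhd : ∀ x, x ∈ nhd x
  eqn : ∀ x, Γ(X, nhd x)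
  isLocalEquation : ∀ x, IsLocalEquation r (nhd x) (eqn x)

/-- The line bundle `𝒪_X(r)`: its transition functions are the quotients of the local equations of
`r`, so that the local equations are a section of it, whose divisor is `r`. -/
noncomputable def LocalEquations.lineBundle [IsIntegral X] {r : X}
    (hr : IsLocalRing.maximalIdeal (X.presheaf.stalk r) ≠ ⊥) (E : LocalEquations r) :
    LineBundle X where
  nhd := E.nhd
  mem_nhd := E.mem_nhd
  trans x y := ((E.isLocalEquation x).exists_unit hr (E.isLocalEquation y)).choose
  cocycle x y z := by
    have hxy := ((E.isLocalEquation x).exists_unit hr (E.isLocalEquation y)).choose_spec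
    have hyz := ((E.isLocalEquation y).exists_unit hr (E.isLocalEquation z)).choose_spec
    have hxz := ((E.isLocalEquation x).exists_unit hr (E.isLocalEquation z)).choose_spec
    generalize ((E.isLocalEquation x).exists_unit hr (E.isLocalEquation y)).choose = a at *
    generalize ((E.isLocalEquation y).exists_unit hr (E.isLocalEquation z)).choose = b at *
    generalize ((E.isLocalEquation x).exists_unit hr (E.isLocalEquation z)).choose = c at *
    ext
    refine TopCat.Presheaf.section_ext X.sheaf _ _ _ fun w hw => ?_
    have hwxy : w ∈ E.nhd x ⊓ E.nhd y := hw.1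
    have hwz : w ∈ E.nhd z := hw.2
    have hwyz : w ∈ E.nhd y ⊓ E.nhd z := ⟨hw.1.2, hw.2⟩
    have hwxz : w ∈ E.nhd x ⊓ E.nhd z := ⟨hw.1.1, hw.2⟩
    have h1 := congrArg (X.presheaf.germ _ w hwxy) hxy
    have h2 := congrArg (X.presheaf.germ _ w hwyz) hyz
    have h3 := congrArg (X.presheaf.germ _ w hwxz) hxz
    rw [map_mul, TopCat.Presheaf.germ_res_apply, TopCat.Presheaf.germ_res_apply] at h1 h2 h3
    refine mul_right_cancel₀ (M₀ := X.presheaf.stalk w)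
      ((E.isLocalEquation z).germ_ne_zero hr w hwz) ?_
    have e1 : X.presheaf.germ (E.nhd x ⊓ E.nhd y ⊓ E.nhd z) w hw
        (X.presheaf.map (homOfLE inf_le_left).op (a : Γ(X, E.nhd x ⊓ E.nhd y))) = _ :=
      TopCat.Presheaf.germ_res_apply _ _ _ _ _
    have e2 : X.presheaf.germ (E.nhd x ⊓ E.nhd y ⊓ E.nhd z) w hw
        (X.presheaf.map (homOfLE (le_inf (inf_le_left.trans inf_le_right) inf_le_right)).op
          (b : Γ(X, E.nhd y ⊓ E.nhd z))) = _ :=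
      TopCat.Presheaf.germ_res_apply _ _ _ _ _
    have e3 : X.presheaf.germ (E.nhd x ⊓ E.nhd y ⊓ E.nhd z) w hw
        (X.presheaf.map (homOfLE (le_inf (inf_le_left.trans inf_le_left) inf_le_right)).op
          (c : Γ(X, E.nhd x ⊓ E.nhd z))) = _ :=
      TopCat.Presheaf.germ_res_apply _ _ _ _ _
    refine (congrArg (· * _) ((map_mul (X.presheaf.germ _ w hw).hom _ _).trans
      (congrArg₂ (· * ·) e1 e2))).trans (Eq.trans ?_ (congrArg (· * _) e3.symm))
    exact (mul_assoc _ _ _).trans ((congrArg (_ * ·) h2.symm).trans (h1.symm.trans h3))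

/-- Closed points whose local ring is a discrete valuation ring have local equations. -/
theorem exists_localEquations [IsIntegral X] [IsLocallyNoetherian X] (r : X) (hr : IsClosed {r})
    [IsDiscreteValuationRing (X.presheaf.stalk r)] : Nonempty (LocalEquations r) := by
  suffices h : ∀ x : X, ∃ (U : X.Opens) (_ : x ∈ U) (f : Γ(X, U)), IsLocalEquation r U f by
    choose U hU f hf using h
    exact ⟨⟨U, hU, f, hf⟩⟩
  intro x
  by_cases hxr : x = r
  · subst hxr
    obtain ⟨V, hV, hxV, -⟩ := exists_isAffineOpen_mem_and_subset (X := X) (x := x) (U := ⊤) trivial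
    obtain ⟨v, rfl⟩ : ∃ v : V, (v : X) = x := ⟨⟨x, hxV⟩, rfl⟩
    have hN : IsNoetherianRing Γ(X, V) := IsLocallyNoetherian.component_noetherian ⟨V, hV⟩
    have hmax := hV.primeIdealOf_isMaximal_of_isClosed v hr
    have hloc := hV.isLocalization_stalk v
    set q := (hV.primeIdealOf v).asIdeal with hq
    have mem_prime : ∀ (w : V) (a : Γ(X, V)), a ∈ (hV.primeIdealOf w).asIdeal ↔
        ¬ IsUnit (X.presheaf.germ V w w.2 a) := by
      intro w a
      rw [hV.primeIdealOf_eq_map_closedPoint w]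
      exact (IsLocalRing.mem_maximalIdeal _)
    obtain ⟨ϖ, hϖ⟩ := IsDiscreteValuationRing.exists_irreducible (X.presheaf.stalk (v : X))
    obtain ⟨⟨a, t⟩, hat⟩ := IsLocalization.surj q.primeCompl ϖ
    have hspan : Ideal.span {X.presheaf.germ V v v.2 a} =
        IsLocalRing.maximalIdeal (X.presheaf.stalk (v : X)) := by
      rw [hϖ.maximalIdeal_eq]
      have ht := IsLocalization.map_units (X.presheaf.stalk (v : X)) t
      refine (Ideal.span_singleton_eq_span_singleton.mpr ?_)
      exact ⟨ht.unit⁻¹, by rw [Units.mul_inv_eq_iff_eq_mul]; exact hat.symm⟩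
    have hs : ∃ s ∉ q, ∀ b ∈ q, s * b ∈ Ideal.span {a} := by
      have h1 : ∀ b, b ∈ q → ∃ s ∉ q, s * b ∈ Ideal.span {a} := by
        intro b hb
        have hb' : X.presheaf.germ V v v.2 b ∈ Ideal.span {X.presheaf.germ V v v.2 a} := by
          rw [hspan]
          exact (IsLocalRing.mem_maximalIdeal _).mpr ((mem_prime v b).mp hb)
        obtain ⟨c, hc⟩ := Ideal.mem_span_singleton'.mp hb'
        obtain ⟨⟨d, t'⟩, hdt⟩ := IsLocalization.surj q.primeCompl c
        have e : algebraMap Γ(X, V) (X.presheaf.stalk (v : X)) (t' * b) =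
            algebraMap Γ(X, V) (X.presheaf.stalk (v : X)) (d * a) := by
          rw [map_mul, map_mul, ← hdt]
          refine (congrArg (_ * ·) hc.symm).trans ?_
          rw [mul_comm c (algebraMap _ _ _), mul_assoc]
          rfl
        obtain ⟨t'', ht''⟩ := (IsLocalization.eq_iff_exists q.primeCompl _).mp e
        refine ⟨t'' * t', q.primeCompl.mul_mem t''.2 t'.2, ?_⟩
        rw [mul_assoc, ht'', ← mul_assoc]
        exact Ideal.mul_mem_left _ _ (Ideal.mem_span_singleton_self a)
      choose! σ hσ hσ' using h1
      obtain ⟨T, hT⟩ := IsNoetherian.noetherian q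
      have hTq : ∀ b ∈ T, b ∈ q := fun b hb => hT ▸ Submodule.subset_span hb
      refine ⟨∏ b ∈ T, σ b, ?_, fun b hb => ?_⟩
      · exact q.primeCompl.prod_mem fun b hb => hσ b (hTq b hb)
      · rw [← hT] at hb
        induction hb using Submodule.span_induction with
        | mem b hb =>
          obtain ⟨e, he⟩ := Finset.dvd_prod_of_mem σ hb
          rw [he, mul_right_comm]
          exact Ideal.mul_mem_right _ _ (hσ' b (hTq b hb))
        | zero => simp
        | add x y _ _ hx hy => rw [mul_add]; exact Ideal.add_mem _ hx hy
        | smul c x _ hx =>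
          rw [smul_eq_mul, mul_left_comm]
          exact Ideal.mul_mem_left _ _ hx
    obtain ⟨s, hsq, hs⟩ := hs
    refine ⟨X.basicOpen s, ?_, X.presheaf.map (homOfLE (X.basicOpen_le s)).op a, ?_, ?_⟩
    · rw [X.mem_basicOpen s v v.2]
      by_contra h
      exact hsq ((mem_prime v s).mpr h)
    · intro z hz hne
      rw [TopCat.Presheaf.germ_res_apply]
      by_contra h
      apply hne
      have hzV : z ∈ V := X.basicOpen_le s hz
      have ha : a ∈ (hV.primeIdealOf ⟨z, hzV⟩).asIdeal := (mem_prime ⟨z, hzV⟩ a).mpr h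
      have hsz : s ∉ (hV.primeIdealOf ⟨z, hzV⟩).asIdeal := fun h' =>
        (mem_prime ⟨z, hzV⟩ s).mp h' ((X.mem_basicOpen s z hzV).mp hz)
      have hle : q ≤ (hV.primeIdealOf ⟨z, hzV⟩).asIdeal := fun b hb =>
        ((hV.primeIdealOf ⟨z, hzV⟩).2.mem_or_mem
          ((Ideal.span_singleton_le_iff_mem _).mpr ha (hs b hb))).resolve_left hsz
      have heq := hmax.eq_of_le (hV.primeIdealOf ⟨z, hzV⟩).2.ne_top hle
      have : hV.primeIdealOf v = hV.primeIdealOf ⟨z, hzV⟩ := PrimeSpectrum.ext heq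
      have := congrArg hV.fromSpec this
      rwa [hV.fromSpec_primeIdealOf, hV.fromSpec_primeIdealOf, eq_comm] at this
    · intro _
      rw [TopCat.Presheaf.germ_res_apply]
      exact hspan
  · exact ⟨⟨{r}ᶜ, hr.isOpen_compl⟩, hxr, 1, fun z hz hne => by rw [map_one]; exact isUnit_one,
      fun h => absurd rfl h⟩

end Points

/-! ### Local rings of smooth curves -/

/-- A domain étale over a polynomial ring in one variable over a field has discrete valuation rings
as local rings at its maximal ideals. -/
theorem isDVR_of_etale {K B : Type*} [Field K] [CommRing B] [IsDomain B]
    [Algebra (MvPolynomial (Fin 1) K) B] [Algebra.Etale (MvPolynomial (Fin 1) K) B]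
    (q : Ideal B) [hq : q.IsMaximal] :
    IsDiscreteValuationRing (Localization.AtPrime q) := by
  let A := MvPolynomial (Fin 1) K
  let e : A ≃ₐ[K] Polynomial K := MvPolynomial.uniqueAlgEquiv K (Fin 1)
  have : IsPrincipalIdealRing A :=
    IsPrincipalIdealRing.of_surjective e.symm.toRingHom e.symm.surjective
  have hA : ¬ IsField A := fun h => Polynomial.not_isField K
    (MulEquiv.isField h e.symm.toRingEquiv.toMulEquiv)
  have : IsJacobsonRing A := inferInstance
  have : IsNoetherianRing B := Algebra.FiniteType.isNoetherianRing A B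
  let p := q.under A
  have hp : p.IsMaximal := by
    let : Field (B ⧸ q) := Ideal.Quotient.field q
    have : Algebra.FiniteType A (B ⧸ q) := .trans (S := B) inferInstance inferInstance
    have : Module.Finite A (B ⧸ q) := finite_of_finite_type_of_isJacobsonRing A (B ⧸ q)
    have h := Ideal.isMaximal_comap_of_isIntegral_of_isMaximal (R := A) (⊥ : Ideal (B ⧸ q))
    have : p = Ideal.comap (algebraMap A (B ⧸ q)) ⊥ := by
      ext x
      change algebraMap A B x ∈ q ↔ algebraMap A (B ⧸ q) x ∈ (⊥ : Ideal (B ⧸ q))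
      rw [IsScalarTower.algebraMap_apply A B (B ⧸ q), Ideal.mem_bot]
      exact Ideal.Quotient.eq_zero_iff_mem.symm
    rwa [this]
  have hp0 : p ≠ ⊥ := Ring.ne_bot_of_isMaximal_of_not_isField hp hA
  have hinj : Function.Injective (algebraMap A B) := by
    exact FaithfulSMul.algebraMap_injective A B
  have hq0 : q ≠ ⊥ := by
    intro h
    apply hp0
    rw [eq_bot_iff]
    intro x hx
    have : algebraMap A B x ∈ q := hx
    rw [h] at this
    exact hinj (by simpa using this)
  let := Localization.AtPrime.algebraOfLiesOver p q
  have hm := ((Algebra.isUnramifiedAt_iff_map_eq A p q).mp inferInstance).2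
  refine ((IsDiscreteValuationRing.TFAE (Localization.AtPrime q)
      (IsLocalization.AtPrime.not_isField B hq0 (Localization.AtPrime q))).out 4 0).mp ?_
  rw [← hm]
  infer_instance

/-- The local rings of a smooth integral curve at its closed points are discrete valuation rings. -/
theorem isDVR_stalk {X : Scheme.{u}} [IsIntegral X] {K : Type u} [Field K]
    (p : X ⟶ Spec (.of K)) [hp : SmoothOfRelativeDimension 1 p] (r : X) (hr : IsClosed {r}) :
    IsDiscreteValuationRing (X.presheaf.stalk r) := by
  obtain ⟨U, hU, V, hV, hrV, e, hst⟩ := hp.exists_isStandardSmoothOfRelativeDimension r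
  have hUtop : U = ⊤ := by
    rw [eq_top_iff]
    rintro x -
    have : x = p r := Subsingleton.elim (α := PrimeSpectrum K) _ _
    rw [this]; exact e hrV
  subst hUtop
  have : Nonempty V := ⟨⟨r, hrV⟩⟩
  have hF : IsField Γ(Spec (.of K), ⊤) :=
    MulEquiv.isField (Field.toIsField K)
      (Scheme.ΓSpecIso (.of K)).commRingCatIsoToRingEquiv.toMulEquiv
  let : Field Γ(Spec (.of K), ⊤) := hF.toField
  obtain ⟨g, -, hg⟩ := hst.exists_etale_mvPolynomial
  let := g.toAlgebra
  have : Algebra.Etale (MvPolynomial (Fin 1) Γ(Spec (.of K), ⊤)) Γ(X, V) := hg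
  obtain ⟨v, rfl⟩ : ∃ v : V, (v : X) = r := ⟨⟨r, hrV⟩, rfl⟩
  have hmax := hV.primeIdealOf_isMaximal_of_isClosed v hr
  have := isDVR_of_etale (K := Γ(Spec (.of K), ⊤)) (hV.primeIdealOf v).asIdeal
  have := hV.isLocalization_stalk v
  exact IsDiscreteValuationRing.RingEquivClass.isDiscreteValuationRing (IsLocalization.algEquiv
    (hV.primeIdealOf v).asIdeal.primeCompl
    (Localization.AtPrime (hV.primeIdealOf v).asIdeal) (X.presheaf.stalk (v : X))).toRingEquiv

/-! ### Smooth projective curves over `ℂ` and their involutions -/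

/-- A smooth projective (irreducible) curve over `ℂ`: an integral scheme, smooth of relative
dimension one and proper over `ℂ` (for curves, proper is the same as projective). -/
class IsSmoothProjectiveCurve (C : Scheme.{0}) [C.Over (Spec (.of ℂ))] : Prop where
  isIntegral : IsIntegral C
  smooth : SmoothOfRelativeDimension 1 (C ↘ Spec (.of ℂ))
  proper : IsProper (C ↘ Spec (.of ℂ))

attribute [instance] IsSmoothProjectiveCurve.isIntegral IsSmoothProjectiveCurve.smooth
  IsSmoothProjectiveCurve.proper

section Curve

variable (C : Scheme.{0}) [C.Over (Spec (.of ℂ))] [IsSmoothProjectiveCurve C]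

theorem isDiscreteValuationRing_stalk (r : C) (hr : IsClosed {r}) :
    IsDiscreteValuationRing (C.presheaf.stalk r) :=
  isDVR_stalk (C ↘ Spec (.of ℂ)) r hr

theorem nonempty_localEquations (r : C) (hr : IsClosed {r}) : Nonempty (LocalEquations r) :=
  have := isDiscreteValuationRing_stalk C r hr
  have : IsLocallyNoetherian C := LocallyOfFiniteType.isLocallyNoetherian (C ↘ Spec (.of ℂ))
  exists_localEquations r hr

/-- The line bundle `𝒪_C(r)` of a closed point `r` of the curve `C`. -/
noncomputable def pointBundle (r : C) (hr : IsClosed {r}) : LineBundle C :=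
  have := isDiscreteValuationRing_stalk C r hr
  (nonempty_localEquations C r hr).some.lineBundle (IsDiscreteValuationRing.not_a_field _)

end Curve

section Involution

variable {C : Scheme.{0}} (σ : C ⟶ C)

/-- The fixed locus of `σ`, as a set of closed points. -/
def fixedLocus : Set C := {x | IsClosed {x} ∧ σ x = x}

/-- The group of line bundles `L` with `σ^* L ≅ L`. -/
noncomputable def invariantPic : AddSubgroup (Pic C) :=
  (Pic.pullback σ).eqLocus (AddMonoidHom.id _)

/-- The homomorphism `ℤ^R → Pic C` which maps `r ∈ R` to the class of `𝒪_C(r)`, where `R` is the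
fixed locus of `σ`. -/
noncomputable def fixedDivisorClass [C.Over (Spec (.of ℂ))] [IsSmoothProjectiveCurve C] :
    (fixedLocus σ →₀ ℤ) →+ Pic C :=
  Finsupp.liftAddHom fun r => zmultiplesHom (Pic C) (Pic.mk (pointBundle C r r.2.1))

/-- `π : C ⟶ B` is the quotient of `C` by the involution `σ`: the fibres of `π` are the orbits of
`σ`, the space `B` has the quotient topology, and the functions on an open `V` of `B` are the
`σ`-invariant functions on `π⁻¹ V`. -/
structure IsQuotient {B : Scheme.{0}} (π : C ⟶ B) : Prop where
  comm : σ ≫ π = π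
  isQuotientMap : Topology.IsQuotientMap π
  orbit : ∀ x y : C, π x = π y → y = x ∨ y = σ x
  injective : ∀ V : B.Opens, Function.Injective (π.app V)
  invariant : ∀ (V : B.Opens) (h : π ⁻¹ᵁ V ≤ σ ⁻¹ᵁ (π ⁻¹ᵁ V)) (s : Γ(C, π ⁻¹ᵁ V)),
    σ.appLE (π ⁻¹ᵁ V) (π ⁻¹ᵁ V) h s = s → ∃ t : Γ(B, V), π.app V t = s

end Involution

end CurveInvolution

open CurveInvolution

namespace CurveInvolution

/-! ### Rational functions and units of local rings -/

section Rational

variable {X : Scheme.{u}} [IsIntegral X]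

theorem genericPoint_mem {U : X.Opens} {x : X} (hx : x ∈ U) : genericPoint X ∈ U :=
  ((genericPoint_spec X).mem_open_set_iff U.isOpen).mpr ⟨x, trivial, hx⟩

/-- An invertible function on a nonempty open, viewed as a rational function. -/
noncomputable def ratUnit {U : X.Opens} (hU : genericPoint X ∈ U) :
    Γ(X, U)ˣ →* X.functionFieldˣ :=
  Units.map (X.presheaf.germ U (genericPoint X) hU).hom.toMonoidHom

theorem coe_ratUnit {U : X.Opens} (hU : genericPoint X ∈ U) (s : Γ(X, U)ˣ) :
    (ratUnit hU s : X.functionField) = X.presheaf.germ U (genericPoint X) hU s := rfl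

theorem ratUnit_injective {U : X.Opens} (hU : genericPoint X ∈ U) :
    Function.Injective (ratUnit hU) :=
  Units.map_injective (germ_injective_of_isIntegral X _ hU)

theorem ratUnit_resUnits {U V : X.Opens} (h : V ≤ U) (hV : genericPoint X ∈ V) (s : Γ(X, U)ˣ) :
    ratUnit hV (resUnits h s) = ratUnit (h hV) s := by
  ext
  exact TopCat.Presheaf.germ_res_apply X.presheaf (homOfLE h) _ _ _

/-- The subgroup of rational functions which are invertible at the point `x`. -/
noncomputable def unitsAt (x : X) : Subgroup X.functionFieldˣ :=
  (Units.map (algebraMap (X.presheaf.stalk x) X.functionField).toMonoidHom).range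

theorem algebraMap_germ {U : X.Opens} {x : X} (hx : x ∈ U) (s : Γ(X, U)) :
    algebraMap (X.presheaf.stalk x) X.functionField (X.presheaf.germ U x hx s) =
      X.presheaf.germ U (genericPoint X) (genericPoint_mem hx) s :=
  TopCat.Presheaf.germ_stalkSpecializes_apply X.presheaf hx ((genericPoint_spec X).specializes trivial) s

theorem ratUnit_mem_unitsAt {U : X.Opens} {x : X} (hx : x ∈ U) (hU : genericPoint X ∈ U)
    (s : Γ(X, U)ˣ) : ratUnit hU s ∈ unitsAt x := by
  refine ⟨Units.map (X.presheaf.germ U x hx).hom.toMonoidHom s, ?_⟩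
  ext
  exact algebraMap_germ hx _

theorem exists_germ_eq_of_local {U : X.Opens} (hU : genericPoint X ∈ U) (f : X.functionField)
    (h : ∀ x ∈ U, f ∈ (algebraMap (X.presheaf.stalk x) X.functionField).range) :
    ∃ s : Γ(X, U), X.presheaf.germ U (genericPoint X) hU s = f := by
  have loc : ∀ x : U, ∃ (V : X.Opens) (hx : (x : X) ∈ V) (_ : V ≤ U) (s : Γ(X, V)),
      X.presheaf.germ V (genericPoint X) (genericPoint_mem hx) s = f := by
    rintro ⟨x, hx⟩
    obtain ⟨a, ha⟩ := h x hx
    obtain ⟨V, hxV, v, rfl⟩ := X.presheaf.exists_germ_eq a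
    refine ⟨V ⊓ U, ⟨hxV, hx⟩, inf_le_right, X.presheaf.map (homOfLE inf_le_left).op v, ?_⟩
    rw [TopCat.Presheaf.germ_res_apply, ← ha, algebraMap_germ]
  choose V hV hVU v hv using loc
  have hcov : U ≤ iSup V := fun z hz => Opens.mem_iSup.mpr ⟨⟨z, hz⟩, hV _⟩
  have hcomp : TopCat.Presheaf.IsCompatible X.presheaf V v := by
    intro i j
    apply germ_injective_of_isIntegral X (genericPoint X)
      (show genericPoint X ∈ V i ⊓ V j from ⟨genericPoint_mem (hV i), genericPoint_mem (hV j)⟩)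
    exact (TopCat.Presheaf.germ_res_apply _ _ _ _ _).trans ((hv i).trans ((hv j).symm.trans
      (TopCat.Presheaf.germ_res_apply _ _ _ _ _).symm))
  obtain ⟨s, hs, -⟩ := X.sheaf.existsUnique_gluing' V U (fun i => homOfLE (hVU i)) hcov v hcomp
  refine ⟨s, ?_⟩
  have h1 := hs ⟨_, hU⟩
  rw [← hv ⟨_, hU⟩, ← h1]
  exact (TopCat.Presheaf.germ_res_apply _ _ _ _ _).symm

theorem mem_range_of_mem_unitsAt {x : X} {f : X.functionFieldˣ} (h : f ∈ unitsAt x) :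
    (f : X.functionField) ∈ (algebraMap (X.presheaf.stalk x) X.functionField).range := by
  obtain ⟨a, rfl⟩ := h
  exact ⟨a, rfl⟩

/-- A rational function which is invertible at all points of `U` is an invertible function
on `U`. -/
theorem exists_ratUnit_eq {U : X.Opens} (hU : genericPoint X ∈ U) (f : X.functionFieldˣ)
    (h : ∀ x ∈ U, f ∈ unitsAt x) : ∃ s, ratUnit hU s = f := by
  obtain ⟨s, hs⟩ := exists_germ_eq_of_local hU f fun x hx => mem_range_of_mem_unitsAt (h x hx)
  obtain ⟨t, ht⟩ := exists_germ_eq_of_local hU ↑f⁻¹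
    fun x hx => mem_range_of_mem_unitsAt (inv_mem (h x hx))
  have hst : s * t = 1 := by
    apply germ_injective_of_isIntegral X _ hU
    rw [map_mul, hs, ht, map_one, Units.mul_inv]
  exact ⟨⟨s, t, hst, by rw [mul_comm, hst]⟩, Units.ext hs⟩

theorem exists_nhds_ratUnit_eq {x : X} {f : X.functionFieldˣ} (h : f ∈ unitsAt x) :
    ∃ (U : X.Opens) (hx : x ∈ U) (s : Γ(X, U)ˣ), ratUnit (genericPoint_mem hx) s = f := by
  obtain ⟨a, rfl⟩ := h
  obtain ⟨U, hU, s, hs⟩ := X.presheaf.exists_germ_eq (a : X.presheaf.stalk x)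
  obtain ⟨V, hV, t, ht⟩ := X.presheaf.exists_germ_eq (a⁻¹.val : X.presheaf.stalk x)
  have hst : X.presheaf.map (homOfLE inf_le_left).op s *
      X.presheaf.map (homOfLE (inf_le_right : U ⊓ V ≤ V)).op t = 1 := by
    apply germ_injective_of_isIntegral X x (show x ∈ U ⊓ V from ⟨hU, hV⟩)
    rw [map_mul, TopCat.Presheaf.germ_res_apply, TopCat.Presheaf.germ_res_apply, hs, ht,
      map_one, Units.mul_inv]
  refine ⟨U ⊓ V, ⟨hU, hV⟩, ⟨_, _, hst, by rw [mul_comm, hst]⟩, Units.ext ?_⟩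
  refine (TopCat.Presheaf.germ_res_apply X.presheaf (homOfLE inf_le_left) _ _ s).trans ?_
  rw [← algebraMap_germ hU, hs]
  rfl

theorem isOpen_mem_unitsAt (f : X.functionFieldˣ) : IsOpen {x : X | f ∈ unitsAt x} := by
  refine isOpen_iff_forall_mem_open.mpr fun x hx => ?_
  obtain ⟨U, hxU, s, hs⟩ := exists_nhds_ratUnit_eq hx
  exact ⟨U, fun y hy => hs ▸ ratUnit_mem_unitsAt hy _ s, U.isOpen, hxU⟩

theorem mem_unitsAt_genericPoint (f : X.functionFieldˣ) : f ∈ unitsAt (genericPoint X) := by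
  refine ⟨f, Units.ext ?_⟩
  change (X.presheaf.stalkSpecializes _).hom _ = _
  rw [TopCat.Presheaf.stalkSpecializes_refl]
  rfl

end Rational

/-! ### Local equations of line bundles -/

section Equations

variable {X : Scheme.{u}} [IsIntegral X]

theorem LineBundle.genericPoint_mem_nhd (L : LineBundle X) (x : X) : genericPoint X ∈ L.nhd x :=
  genericPoint_mem (L.mem_nhd x)

theorem LineBundle.genericPoint_mem_inf (L : LineBundle X) (x y : X) :
    genericPoint X ∈ L.nhd x ⊓ L.nhd y :=
  ⟨L.genericPoint_mem_nhd x, L.genericPoint_mem_nhd y⟩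

/-- `h` describes a rational section of `L` in the given trivializations. -/
def LineBundle.IsRationalSection (L : LineBundle X) (h : X → X.functionFieldˣ) : Prop :=
  ∀ x y, ratUnit (L.genericPoint_mem_inf x y) (L.trans x y) * h y = h x

theorem LineBundle.ratUnit_transOn (L : LineBundle X) {x y : X} {W : X.Opens}
    (h : W ≤ L.nhd x ⊓ L.nhd y) (hW : genericPoint X ∈ W) :
    ratUnit hW (L.transOn x y h) = ratUnit (L.genericPoint_mem_inf x y) (L.trans x y) :=
  ratUnit_resUnits _ _ _

theorem LineBundle.exists_isRationalSection (L : LineBundle X) : ∃ h, L.IsRationalSection h := by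
  refine ⟨fun x => ratUnit (L.genericPoint_mem_inf x (genericPoint X))
    (L.trans x (genericPoint X)), fun x y => ?_⟩
  have h := congrArg (ratUnit (show genericPoint X ∈ L.nhd x ⊓ L.nhd y ⊓ L.nhd (genericPoint X)
    from ⟨L.genericPoint_mem_inf x y, L.mem_nhd _⟩))
    (L.cocycle x y (genericPoint X))
  simpa only [map_mul, ratUnit_resUnits] using h

theorem LineBundle.IsRationalSection.tensor {L M : LineBundle X} {h k : X → X.functionFieldˣ}
    (hL : L.IsRationalSection h) (hM : M.IsRationalSection k) :
    (L.tensor M).IsRationalSection (h * k) := by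
  intro x y
  have e : ratUnit ((L.tensor M).genericPoint_mem_inf x y) ((L.tensor M).trans x y) =
      ratUnit (L.genericPoint_mem_inf x y) (L.trans x y) *
        ratUnit (M.genericPoint_mem_inf x y) (M.trans x y) := by
    exact (map_mul _ _ _).trans
      (congrArg₂ (· * ·) (L.ratUnit_transOn _ _) (M.ratUnit_transOn _ _))
  rw [e, Pi.mul_apply, Pi.mul_apply, mul_mul_mul_comm, hL, hM]

theorem LineBundle.IsRationalSection.dual {L : LineBundle X} {h : X → X.functionFieldˣ}
    (hL : L.IsRationalSection h) : L.dual.IsRationalSection h⁻¹ := by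
  intro x y
  refine (congrArg (· * _) (map_inv (ratUnit _) (L.trans x y))).trans ?_
  rw [Pi.inv_apply, Pi.inv_apply, ← mul_inv, hL]

theorem LineBundle.isomorphic_iff {L L' : LineBundle X} {h h' : X → X.functionFieldˣ}
    (hL : L.IsRationalSection h) (hL' : L'.IsRationalSection h') :
    L.Isomorphic L' ↔ ∃ f, ∀ x, h' x * f / h x ∈ unitsAt x := by
  constructor
  · rintro ⟨W, hW, hWL, hWL', a, ha⟩
    let η := genericPoint X
    have hη : ∀ x, η ∈ W x := fun x => genericPoint_mem (hW x)
    refine ⟨h η / (h' η * ratUnit (hη η) (a η)), fun x => ?_⟩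
    have e := congrArg (ratUnit (show η ∈ W x ⊓ W η from ⟨hη x, hη η⟩)) (ha x η)
    simp only [map_mul, ratUnit_resUnits, LineBundle.ratUnit_transOn] at e
    have : h' x * (h η / (h' η * ratUnit (hη η) (a η))) / h x =
        (ratUnit (hη x) (a x))⁻¹ := by
      rw [← hL x η, ← hL' x η, ← mul_eq_one_iff_eq_inv]
      have e' := congrArg Units.val e
      apply Units.ext
      push_cast at e' ⊢
      field_simp
      linear_combination -e'
    rw [this]
    exact inv_mem (ratUnit_mem_unitsAt (hW x) _ _)
  · rintro ⟨f, hf⟩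
    choose U hU s hs using fun x => exists_nhds_ratUnit_eq (hf x)
    refine ⟨fun x => L.nhd x ⊓ L'.nhd x ⊓ U x, fun x => ⟨⟨L.mem_nhd x, L'.mem_nhd x⟩, hU x⟩,
      fun x => inf_le_left.trans inf_le_left, fun x => inf_le_left.trans inf_le_right,
      fun x => resUnits inf_le_right (s x)⁻¹, fun x y => ?_⟩
    have hm : ∀ x, genericPoint X ∈ L.nhd x ⊓ L'.nhd x ⊓ U x := fun x =>
      ⟨⟨L.genericPoint_mem_nhd x, L'.genericPoint_mem_nhd x⟩, genericPoint_mem (hU x)⟩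
    apply ratUnit_injective (show genericPoint X ∈ (L.nhd x ⊓ L'.nhd x ⊓ U x) ⊓
      (L.nhd y ⊓ L'.nhd y ⊓ U y) from ⟨hm x, hm y⟩)
    simp only [map_mul, ratUnit_resUnits, LineBundle.ratUnit_transOn, map_inv, hs]
    rw [← hL x y, ← hL' x y]
    apply Units.ext
    push_cast
    field_simp

theorem LineBundle.exists_isRationalSection_of_isOpen {g : X → X.functionFieldˣ}
    (hg : ∀ x, ∃ U : X.Opens, x ∈ U ∧ ∀ y ∈ U, g y / g x ∈ unitsAt y) :
    ∃ L : LineBundle X, L.IsRationalSection g := by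
  choose U hU h using hg
  have key : ∀ x y, ∃ s : Γ(X, U x ⊓ U y)ˣ,
      ratUnit (show genericPoint X ∈ U x ⊓ U y from
        ⟨genericPoint_mem (hU x), genericPoint_mem (hU y)⟩) s = g x / g y := fun x y => by
    refine exists_ratUnit_eq _ _ fun z hz => ?_
    have := div_mem (h y z hz.2) (h x z hz.1)
    rwa [div_div_div_cancel_left] at this
  choose s hs using key
  refine ⟨⟨U, hU, s, fun x y z => ?_⟩, fun x y => ?_⟩
  · apply ratUnit_injective (show genericPoint X ∈ U x ⊓ U y ⊓ U z from
      ⟨⟨genericPoint_mem (hU x), genericPoint_mem (hU y)⟩, genericPoint_mem (hU z)⟩)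
    simp only [map_mul, ratUnit_resUnits, hs, div_mul_div_cancel]
  · exact (congrArg (· * _) (hs x y)).trans (div_mul_cancel _ _)

theorem LineBundle.IsRationalSection.isOpen {L : LineBundle X} {h : X → X.functionFieldˣ}
    (hL : L.IsRationalSection h) (x : X) :
    ∃ U : X.Opens, x ∈ U ∧ ∀ y ∈ U, h y / h x ∈ unitsAt y := by
  refine ⟨L.nhd x, L.mem_nhd x, fun y hy => ?_⟩
  rw [← hL y x, mul_div_cancel_right]
  exact ratUnit_mem_unitsAt (show y ∈ L.nhd y ⊓ L.nhd x from ⟨L.mem_nhd y, hy⟩) _ _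

/-- The functions `g x` are local equations of a Cartier divisor with class `P`. -/
def Pic.HasEquations (P : Pic X) (g : X → X.functionFieldˣ) : Prop :=
  ∃ L h, Pic.mk L = P ∧ L.IsRationalSection h ∧ ∀ x, g x / h x ∈ unitsAt x

namespace Pic

theorem exists_hasEquations (P : Pic X) : ∃ g, P.HasEquations g := by
  obtain ⟨L, rfl⟩ := Quotient.exists_rep P
  obtain ⟨h, hh⟩ := L.exists_isRationalSection
  exact ⟨h, L, h, rfl, hh, fun x => by rw [div_self']; exact one_mem _⟩

theorem HasEquations.add {P Q : Pic X} {g k : X → X.functionFieldˣ} (hP : P.HasEquations g)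
    (hQ : Q.HasEquations k) : (P + Q).HasEquations (g * k) := by
  obtain ⟨L, h, rfl, hL, hg⟩ := hP
  obtain ⟨M, h', rfl, hM, hk⟩ := hQ
  refine ⟨L.tensor M, h * h', rfl, hL.tensor hM, fun x => ?_⟩
  rw [Pi.mul_apply, Pi.mul_apply, mul_div_mul_comm]
  exact mul_mem (hg x) (hk x)

theorem HasEquations.neg {P : Pic X} {g : X → X.functionFieldˣ} (hP : P.HasEquations g) :
    (-P).HasEquations g⁻¹ := by
  obtain ⟨L, h, rfl, hL, hg⟩ := hP
  refine ⟨L.dual, h⁻¹, rfl, hL.dual, fun x => ?_⟩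
  rw [Pi.inv_apply, Pi.inv_apply, inv_div_inv, ← inv_div]
  exact inv_mem (hg x)

theorem HasEquations.eq_iff {P Q : Pic X} {g k : X → X.functionFieldˣ} (hP : P.HasEquations g)
    (hQ : Q.HasEquations k) : P = Q ↔ ∃ f, ∀ x, k x * f / g x ∈ unitsAt x := by
  obtain ⟨L, h, rfl, hL, hg⟩ := hP
  obtain ⟨M, h', rfl, hM, hk⟩ := hQ
  refine Quotient.eq.trans ((LineBundle.isomorphic_iff hL hM).trans
    (exists_congr fun f => forall_congr' fun x => ?_))
  have : k x * f / g x = (h' x * f / h x) * (k x / h' x / (g x / h x)) := by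
    apply Units.ext
    push_cast
    field_simp
  rw [this, Subgroup.mul_mem_cancel_right _ (div_mem (hk x) (hg x))]

theorem HasEquations.congr {P : Pic X} {g k : X → X.functionFieldˣ} (hP : P.HasEquations g)
    (h : ∀ x, k x / g x ∈ unitsAt x) : P.HasEquations k := by
  obtain ⟨L, l, rfl, hL, hg⟩ := hP
  refine ⟨L, l, rfl, hL, fun x => ?_⟩
  rw [← div_mul_div_cancel (k x) (g x) (l x)]
  exact mul_mem (h x) (hg x)

theorem HasEquations.mul_const {P : Pic X} {g : X → X.functionFieldˣ} (hP : P.HasEquations g)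
    (f : X.functionFieldˣ) : P.HasEquations fun x => g x * f := by
  obtain ⟨L, l, rfl, hL, hg⟩ := hP
  refine ⟨L, fun x => l x * f, rfl, fun x y => ?_, fun x => ?_⟩
  · rw [← mul_assoc, hL]
  · rw [mul_div_mul_right_eq_div]; exact hg x

theorem HasEquations.isOpen {P : Pic X} {g : X → X.functionFieldˣ} (hP : P.HasEquations g)
    (f : X.functionFieldˣ) : IsOpen {x : X | f / g x ∈ unitsAt x} := by
  obtain ⟨L, l, rfl, hL, hg⟩ := hP
  refine isOpen_iff_forall_mem_open.mpr fun x hx => ?_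
  obtain ⟨U, hxU, hU⟩ := hL.isOpen x
  have hf : f / l x ∈ unitsAt x := by
    rw [← div_mul_div_cancel f (g x) (l x)]
    exact mul_mem hx (hg x)
  refine ⟨U ∩ {y | f / l x ∈ unitsAt y}, fun y hy => ?_,
    U.isOpen.inter (isOpen_mem_unitsAt _), hxU, hf⟩
  have := div_mem (div_mem hy.2 (hU y hy.1)) (hg y)
  have e : f / l x / (l y / l x) / (g y / l y) = f / g y := by
    apply Units.ext
    push_cast
    field_simp
  rwa [e] at this

theorem exists_hasEquations_of_isOpen {g : X → X.functionFieldˣ}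
    (hg : ∀ x, ∃ U : X.Opens, x ∈ U ∧ ∀ y ∈ U, g y / g x ∈ unitsAt y) :
    ∃ P : Pic X, P.HasEquations g := by
  obtain ⟨L, hL⟩ := LineBundle.exists_isRationalSection_of_isOpen hg
  exact ⟨mk L, L, g, rfl, hL, fun x => by rw [div_self']; exact one_mem _⟩

end Pic

end Equations
/-! ### Pullback of rational functions and local equations -/

section Pullback

variable {X Y Z : Scheme.{u}} [IsIntegral X] [IsIntegral Y] [IsIntegral Z]

/-- Pullback of rational functions along a dominant morphism. -/
noncomputable def funMap (f : X ⟶ Y) (hf : f (genericPoint X) = genericPoint Y) :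
    Y.functionField →+* X.functionField :=
  (Y.presheaf.stalkSpecializes (specializes_of_eq hf) ≫ f.stalkMap (genericPoint X)).hom

theorem funMap_germ (f : X ⟶ Y) (hf : f (genericPoint X) = genericPoint Y) {U : Y.Opens}
    (hU : genericPoint Y ∈ U) {V : X.Opens} (hV : genericPoint X ∈ V) (h : V ≤ f ⁻¹ᵁ U)
    (s : Γ(Y, U)) : funMap f hf (Y.presheaf.germ U _ hU s) =
      X.presheaf.germ V _ hV (f.appLE U V h s) := by
  have e : Y.presheaf.germ U _ hU ≫ Y.presheaf.stalkSpecializes (specializes_of_eq hf) ≫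
      f.stalkMap (genericPoint X) = f.appLE U V h ≫ X.presheaf.germ V _ hV := by
    rw [TopCat.Presheaf.germ_stalkSpecializes_assoc, Scheme.Hom.germ_stalkMap,
      Scheme.Hom.appLE, Category.assoc, TopCat.Presheaf.germ_res]
  exact congrArg (fun φ => φ.hom s) e

/-- Two ring homomorphisms on the function field agree if they agree on germs. -/
theorem functionField_hom_ext {A : Type*} [Semiring A] {φ ψ : Y.functionField →+* A}
    (h : ∀ (U : Y.Opens) (hU : genericPoint Y ∈ U) (s : Γ(Y, U)),
      φ (Y.presheaf.germ U _ hU s) = ψ (Y.presheaf.germ U _ hU s)) : φ = ψ := by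
  ext a
  obtain ⟨U, hU, s, rfl⟩ := Y.presheaf.exists_germ_eq a
  exact h U hU s

theorem funMap_comp (f : X ⟶ Y) (g : Y ⟶ Z) (hf : f (genericPoint X) = genericPoint Y)
    (hg : g (genericPoint Y) = genericPoint Z)
    (hfg : (f ≫ g) (genericPoint X) = genericPoint Z) :
    (funMap f hf).comp (funMap g hg) = funMap (f ≫ g) hfg := by
  refine functionField_hom_ext fun U hU s => ?_
  have hV : genericPoint Y ∈ g ⁻¹ᵁ U := show g _ ∈ U by rwa [hg]
  have hW : genericPoint X ∈ f ⁻¹ᵁ g ⁻¹ᵁ U := show f _ ∈ g ⁻¹ᵁ U by rwa [hf]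
  rw [RingHom.comp_apply, funMap_germ g hg hU hV le_rfl, funMap_germ f hf hV hW le_rfl]
  refine Eq.trans ?_ (funMap_germ (f ≫ g) hfg hU (V := f ⁻¹ᵁ g ⁻¹ᵁ U) hW (fun _ h => h) s).symm
  exact congrArg (fun φ => X.presheaf.germ (f ⁻¹ᵁ g ⁻¹ᵁ U) _ hW (φ.hom s))
    (Scheme.Hom.appLE_comp_appLE f g U (g ⁻¹ᵁ U) (f ⁻¹ᵁ g ⁻¹ᵁ U) le_rfl le_rfl)

theorem funMap_id (h : (𝟙 X : X ⟶ X) (genericPoint X) = genericPoint X) :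
    funMap (𝟙 X) h = RingHom.id _ := by
  refine functionField_hom_ext fun U hU s => ?_
  refine (funMap_germ _ h hU hU (fun _ h => h) s).trans ?_
  have e : (𝟙 X : X ⟶ X).appLE U U (fun _ h => h) = X.presheaf.map (homOfLE le_rfl).op :=
    Category.id_comp (X.presheaf.map (homOfLE le_rfl).op)
  rw [e]
  exact TopCat.Presheaf.germ_res_apply X.presheaf (homOfLE le_rfl) _ _ _

/-- Pullback of nonzero rational functions along a dominant morphism. -/
noncomputable def ratPull (f : X ⟶ Y) (hf : f (genericPoint X) = genericPoint Y) :
    Y.functionFieldˣ →* X.functionFieldˣ :=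
  Units.map (funMap f hf).toMonoidHom

theorem ratPull_injective (f : X ⟶ Y) (hf : f (genericPoint X) = genericPoint Y) :
    Function.Injective (ratPull f hf) :=
  Units.map_injective (funMap f hf).injective

theorem ratPull_ratUnit (f : X ⟶ Y) (hf : f (genericPoint X) = genericPoint Y) {U : Y.Opens}
    (hU : genericPoint Y ∈ U) {V : X.Opens} (hV : genericPoint X ∈ V) (h : V ≤ f ⁻¹ᵁ U)
    (s : Γ(Y, U)ˣ) : ratPull f hf (ratUnit hU s) = ratUnit hV (pullUnits f h s) :=
  Units.ext (funMap_germ f hf hU hV h _)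

theorem ratPull_mem_unitsAt (f : X ⟶ Y) (hf : f (genericPoint X) = genericPoint Y) {x : X}
    {k : Y.functionFieldˣ} (hk : k ∈ unitsAt (f x)) : ratPull f hf k ∈ unitsAt x := by
  obtain ⟨U, hU, s, rfl⟩ := exists_nhds_ratUnit_eq hk
  have hx : x ∈ f ⁻¹ᵁ U := hU
  rw [ratPull_ratUnit f hf _ (genericPoint_mem hx) le_rfl]
  exact ratUnit_mem_unitsAt hx _ _

theorem LineBundle.IsRationalSection.pullback (f : X ⟶ Y)
    (hf : f (genericPoint X) = genericPoint Y) {L : LineBundle Y} {h : Y → Y.functionFieldˣ}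
    (hL : L.IsRationalSection h) :
    (L.pullback f).IsRationalSection fun x => ratPull f hf (h (f x)) := by
  intro x y
  change _ * ratPull f hf (h (f y)) = ratPull f hf (h (f x))
  rw [← hL (f x) (f y), map_mul]
  exact congrArg (· * _) (ratPull_ratUnit f hf (L.genericPoint_mem_inf (f x) (f y))
    ((L.pullback f).genericPoint_mem_inf x y) _ _).symm

theorem Pic.HasEquations.pullback (f : X ⟶ Y) (hf : f (genericPoint X) = genericPoint Y)
    {P : Pic Y} {g : Y → Y.functionFieldˣ} (hP : P.HasEquations g) :
    (Pic.pullback f P).HasEquations fun x => ratPull f hf (g (f x)) := by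
  obtain ⟨L, h, rfl, hL, hg⟩ := hP
  refine ⟨L.pullback f, _, rfl, hL.pullback f hf, fun x => ?_⟩
  rw [← map_div]
  exact ratPull_mem_unitsAt f hf (hg (f x))

theorem LocalEquations.isRationalSection {r : X}
    (hr : IsLocalRing.maximalIdeal (X.presheaf.stalk r) ≠ ⊥) (E : LocalEquations r)
    {h : X → X.functionFieldˣ}
    (hh : ∀ x, (h x : X.functionField) =
      X.presheaf.germ (E.nhd x) (genericPoint X) (genericPoint_mem (E.mem_nhd x)) (E.eqn x)) :
    (E.lineBundle hr).IsRationalSection h := by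
  intro x y
  apply Units.ext
  have hη : genericPoint X ∈ E.nhd x ⊓ E.nhd y :=
    ⟨genericPoint_mem (E.mem_nhd x), genericPoint_mem (E.mem_nhd y)⟩
  have h1 := congrArg (X.presheaf.germ _ _ hη)
    ((E.isLocalEquation x).exists_unit hr (E.isLocalEquation y)).choose_spec
  rw [map_mul, TopCat.Presheaf.germ_res_apply, TopCat.Presheaf.germ_res_apply] at h1
  rw [Units.val_mul, hh, hh]
  exact h1.symm

end Pullback
/-! ### The order of a rational function at a discrete valuation ring -/

section Ord

variable (R : Type*) {K : Type*} [CommRing R] [IsDomain R] [IsDiscreteValuationRing R] [Field K]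
  [Algebra R K] [IsFractionRing R K]

variable (K) in
/-- The valuation of `K` defined by the discrete valuation ring `R`. -/
noncomputable abbrev dvrValuation : Valuation K (WithZero (Multiplicative ℤ)) :=
  (IsDiscreteValuationRing.maximalIdeal R).valuation K

/-- The order of a nonzero element of the fraction field of a discrete valuation ring. -/
noncomputable def dvrOrd (f : Kˣ) : ℤ :=
  -WithZero.log (dvrValuation R K f)

theorem dvrOrd_mul (f g : Kˣ) : dvrOrd R (f * g) = dvrOrd R f + dvrOrd R g := by
  rw [dvrOrd, Units.val_mul, map_mul, WithZero.log_mul (by simp) (by simp), neg_add]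
  rfl

theorem dvrValuation_eq_exp (f : Kˣ) : dvrValuation R K f = WithZero.exp (-dvrOrd R f) := by
  rw [dvrOrd, neg_neg, WithZero.exp_log (by simp)]

theorem dvrValuation_le_one_iff (f : K) :
    dvrValuation R K f ≤ 1 ↔ f ∈ (algebraMap R K).range := by
  constructor
  · intro h
    have := IsDiscreteValuationRing.exists_lift_of_le_one (A := R) (K := K) h
    exact this
  · rintro ⟨a, rfl⟩
    exact IsDedekindDomain.HeightOneSpectrum.valuation_le_one _ a

theorem dvrOrd_nonneg_iff (f : Kˣ) : 0 ≤ dvrOrd R f ↔ (f : K) ∈ (algebraMap R K).range := by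
  rw [← dvrValuation_le_one_iff, dvrValuation_eq_exp, ← WithZero.exp_zero, WithZero.exp_le_exp]
  omega

theorem dvrOrd_one : dvrOrd R (1 : Kˣ) = 0 := by
  have := dvrOrd_mul R (1 : Kˣ) 1
  rw [mul_one] at this
  omega

theorem dvrOrd_inv (f : Kˣ) : dvrOrd R f⁻¹ = -dvrOrd R f := by
  have := dvrOrd_mul R f f⁻¹
  rw [mul_inv_cancel, dvrOrd_one] at this
  omega

theorem dvrOrd_pow (f : Kˣ) (n : ℕ) : dvrOrd R (f ^ n) = n * dvrOrd R f := by
  induction n with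
  | zero => simp [dvrOrd_one]
  | succ n ih => rw [pow_succ, dvrOrd_mul, ih]; push_cast; ring

theorem dvrOrd_zpow (f : Kˣ) (n : ℤ) : dvrOrd R (f ^ n) = n * dvrOrd R f := by
  obtain n | n := n
  · simp [dvrOrd_pow]
  · rw [zpow_negSucc, dvrOrd_inv, dvrOrd_pow, Int.negSucc_eq]
    push_cast
    ring

theorem dvrOrd_eq_zero_iff (f : Kˣ) :
    dvrOrd R f = 0 ↔ f ∈ (Units.map (algebraMap R K).toMonoidHom).range := by
  constructor
  · intro h
    obtain ⟨a, ha⟩ := (dvrOrd_nonneg_iff R f).mp h.ge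
    obtain ⟨b, hb⟩ := (dvrOrd_nonneg_iff R f⁻¹).mp (by rw [dvrOrd_inv, h, neg_zero])
    have hab : a * b = 1 := by
      apply IsFractionRing.injective R K
      rw [map_mul, ha, hb, Units.mul_inv, map_one]
    exact ⟨⟨a, b, hab, by rw [mul_comm, hab]⟩, Units.ext ha⟩
  · rintro ⟨a, rfl⟩
    have h1 := (dvrOrd_nonneg_iff R (Units.map (algebraMap R K).toMonoidHom a)).mpr ⟨a, rfl⟩
    have h2 := (dvrOrd_nonneg_iff R (Units.map (algebraMap R K).toMonoidHom a⁻¹)).mpr ⟨_, rfl⟩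
    rw [map_inv, dvrOrd_inv] at h2
    omega

theorem dvrOrd_add {f g h : Kˣ} (e : (f : K) + g = h) {n : ℤ} (hf : n ≤ dvrOrd R f)
    (hg : n ≤ dvrOrd R g) : n ≤ dvrOrd R h := by
  have hle : dvrValuation R K h ≤ WithZero.exp (-n) := by
    rw [← e]
    refine (Valuation.map_add _ _ _).trans (max_le ?_ ?_) <;>
    · rw [dvrValuation_eq_exp, WithZero.exp_le_exp]
      omega
  rw [dvrValuation_eq_exp, WithZero.exp_le_exp] at hle
  omega

theorem dvrOrd_add_eq {f g h : Kˣ} (e : (f : K) + g = h) (hfg : dvrOrd R f < dvrOrd R g) :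
    dvrOrd R h = dvrOrd R f := by
  have h1 := dvrOrd_add R e le_rfl hfg.le
  refine le_antisymm ?_ h1
  by_contra! hlt
  have e' : (h : K) + (-g : Kˣ) = f := by rw [← e]; simp
  have hneg : dvrOrd R (-g) = dvrOrd R g := by
    rw [dvrOrd, Units.val_neg, Valuation.map_neg, dvrOrd]
  have := dvrOrd_add R (n := dvrOrd R f + 1) e' (by omega) (by omega)
  omega

theorem dvrOrd_eq_one {t : R} (ht : Ideal.span {t} = IsLocalRing.maximalIdeal R) {f : Kˣ}
    (hf : (f : K) = algebraMap R K t) : dvrOrd R f = 1 := by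
  have := IsDedekindDomain.HeightOneSpectrum.intValuation_singleton
    (IsDiscreteValuationRing.maximalIdeal R) (r := t) (by
      rintro rfl
      simpa [hf] using f.ne_zero) ht.symm
  rw [dvrOrd, hf, dvrValuation, IsDedekindDomain.HeightOneSpectrum.valuation_of_algebraMap, this]
  simp

theorem exists_dvrOrd_eq_one : ∃ f : Kˣ, dvrOrd R f = 1 := by
  obtain ⟨t, ht⟩ := IsDiscreteValuationRing.exists_irreducible R
  have h0 : algebraMap R K t ≠ 0 := by
    rw [Ne, IsFractionRing.to_map_eq_zero_iff]
    exact ht.ne_zero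
  exact ⟨Units.mk0 _ h0, dvrOrd_eq_one R ht.maximalIdeal_eq.symm rfl⟩

/-- Two distinct discrete valuation rings with the same fraction field do not contain each
other. -/
theorem range_algebraMap_eq_of_le (S : Type*) [CommRing S] [IsDomain S]
    [IsDiscreteValuationRing S] [Algebra S K] [IsFractionRing S K]
    (h : (algebraMap R K).range ≤ (algebraMap S K).range) :
    (algebraMap R K).range = (algebraMap S K).range := by
  refine le_antisymm h ?_
  by_contra hne
  obtain ⟨_, ⟨s, rfl⟩, hs⟩ := SetLike.not_le_iff_exists.mp hne
  have hs0 : algebraMap S K s ≠ 0 := fun h0 => hs (h0 ▸ zero_mem _)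
  set u := Units.mk0 _ hs0
  have hu : dvrOrd R u < 0 := by
    by_contra! h'
    exact hs ((dvrOrd_nonneg_iff R u).mp h')
  obtain ⟨f, hf⟩ := exists_dvrOrd_eq_one S (K := K)
  have key : ∀ g : Kˣ, 0 ≤ dvrOrd S g := by
    intro g
    obtain ⟨n, hn⟩ : ∃ n : ℕ, 0 ≤ dvrOrd R g - n * dvrOrd R u :=
      ⟨(dvrOrd R g).natAbs, by nlinarith [neg_abs_le (dvrOrd R g), Int.natCast_natAbs (dvrOrd R g)]⟩
    have h1 : ((g * (u ^ n)⁻¹ : Kˣ) : K) ∈ (algebraMap R K).range := by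
      rw [← dvrOrd_nonneg_iff, dvrOrd_mul, dvrOrd_inv, dvrOrd_pow]
      omega
    rw [dvrOrd_nonneg_iff]
    have h2 : (u : K) ^ n ∈ (algebraMap S K).range := 
      pow_mem (show (u : K) ∈ (algebraMap S K).range from ⟨s, rfl⟩) n
    have h3 := mul_mem (h h1) h2
    have e : ((g * (u ^ n)⁻¹ : Kˣ) : K) * (u : K) ^ n = g := by
      rw [← Units.val_pow_eq_pow_val, ← Units.val_mul, inv_mul_cancel_right]
    rwa [e] at h3
  have := key f⁻¹
  rw [dvrOrd_inv] at this
  omega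

/-- Weak approximation for two distinct discrete valuation rings. -/
theorem exists_dvrOrd_eq_one_and_eq_zero (S : Type*) [CommRing S] [IsDomain S]
    [IsDiscreteValuationRing S] [Algebra S K] [IsFractionRing S K]
    (h : (algebraMap R K).range ≠ (algebraMap S K).range) :
    ∃ f : Kˣ, dvrOrd R f = 1 ∧ dvrOrd S f = 0 := by
  obtain ⟨a, haR, haS⟩ := SetLike.not_le_iff_exists.mp
    fun hle => h (range_algebraMap_eq_of_le R S hle)
  obtain ⟨b, hbS, hbR⟩ := SetLike.not_le_iff_exists.mp
    fun hle => h (range_algebraMap_eq_of_le S R hle).symm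
  have ha0 : a ≠ 0 := fun h0 => haS (h0 ▸ zero_mem _)
  have hb0 : b ≠ 0 := fun h0 => hbR (h0 ▸ zero_mem _)
  set c : Kˣ := Units.mk0 a ha0 * (Units.mk0 b hb0)⁻¹ with hc
  have hcR : 0 < dvrOrd R c := by
    have h1 := (dvrOrd_nonneg_iff R (Units.mk0 a ha0)).mpr haR
    have h2 := mt (dvrOrd_nonneg_iff R (Units.mk0 b hb0)).mp hbR
    rw [hc, dvrOrd_mul, dvrOrd_inv]
    omega
  have hcS : dvrOrd S c < 0 := by
    have h1 := (dvrOrd_nonneg_iff S (Units.mk0 b hb0)).mpr hbS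
    have h2 := mt (dvrOrd_nonneg_iff S (Units.mk0 a ha0)).mp haS
    rw [hc, dvrOrd_mul, dvrOrd_inv]
    omega
  have hd0 : 1 + (c : K) ≠ 0 := fun h0 => by
    have hc1 : c = -1 := Units.ext (by rw [Units.val_neg, Units.val_one]; linear_combination h0)
    have h2 := dvrOrd_mul R (-1 : Kˣ) (-1)
    rw [neg_mul_neg, mul_one, dvrOrd_one] at h2
    rw [hc1] at hcR
    omega
  set d : Kˣ := Units.mk0 _ hd0
  have hdR : dvrOrd R d = 0 := by
    rw [← dvrOrd_one R (K := K)]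
    exact dvrOrd_add_eq R (f := 1) (g := c) (by simp [d]) (by rw [dvrOrd_one]; exact hcR)
  have hdS : dvrOrd S d = dvrOrd S c :=
    dvrOrd_add_eq S (f := c) (g := 1) (by simp [d, add_comm]) (by rw [dvrOrd_one]; exact hcS)
  obtain ⟨p, hp⟩ := exists_dvrOrd_eq_one R (K := K)
  obtain ⟨n, hn⟩ : ∃ n : ℕ, 0 < dvrOrd S p - n * dvrOrd S d :=
    ⟨(dvrOrd S p).natAbs + 1, by
      push_cast; nlinarith [neg_abs_le (dvrOrd S p), Int.natCast_natAbs (dvrOrd S p)]⟩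
  set y : Kˣ := (c * d⁻¹) ^ 2
  set z : Kˣ := p * (d ^ n)⁻¹
  have hyR : 2 ≤ dvrOrd R y := by
    rw [dvrOrd_pow, dvrOrd_mul, dvrOrd_inv]; push_cast; omega
  have hyS : dvrOrd S y = 0 := by
    rw [dvrOrd_pow, dvrOrd_mul, dvrOrd_inv, hdS]; simp
  have hzR : dvrOrd R z = 1 := by
    rw [dvrOrd_mul, dvrOrd_inv, dvrOrd_pow, hdR, hp]; simp
  have hzS : 0 < dvrOrd S z := by
    rw [dvrOrd_mul, dvrOrd_inv, dvrOrd_pow]; omega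
  have hyz : (y : K) + z ≠ 0 := fun h0 => by
    have hy : y = -1 * z := Units.ext (by push_cast at h0 ⊢; linear_combination h0)
    have h2 := dvrOrd_mul R (-1 : Kˣ) (-1)
    rw [neg_mul_neg, mul_one, dvrOrd_one] at h2
    rw [hy, dvrOrd_mul] at hyR
    omega
  refine ⟨Units.mk0 _ hyz, ?_, ?_⟩
  · rw [← hzR]
    exact dvrOrd_add_eq R (f := z) (g := y) (add_comm _ _) (by omega)
  · rw [← hyS]
    exact dvrOrd_add_eq S (f := y) (g := z) rfl (by omega)

theorem dvrOrd_map {L : Type*} [Field L] (S : Type*) [CommRing S] [IsDomain S]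
    [IsDiscreteValuationRing S] [Algebra S L] [IsFractionRing S L] (φ : K →+* L)
    (hφ : Function.Surjective φ)
    (h : ∀ a ∈ (algebraMap R K).range, φ a ∈ (algebraMap S L).range) (f : Kˣ) :
    dvrOrd S (Units.map φ.toMonoidHom f) = dvrOrd R f := by
  have hnonneg : ∀ g : Kˣ, 0 ≤ dvrOrd R g → 0 ≤ dvrOrd S (Units.map φ.toMonoidHom g) :=
    fun g hg => (dvrOrd_nonneg_iff S _).mpr (h _ ((dvrOrd_nonneg_iff R g).mp hg))
  obtain ⟨t, ht⟩ := exists_dvrOrd_eq_one R (K := K)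
  have key : ∀ g : Kˣ, dvrOrd S (Units.map φ.toMonoidHom g) =
      dvrOrd R g * dvrOrd S (Units.map φ.toMonoidHom t) := by
    intro g
    have h0 : dvrOrd R (g * (t ^ dvrOrd R g)⁻¹) = 0 := by
      rw [dvrOrd_mul, dvrOrd_inv, dvrOrd_zpow, ht]; ring
    have h1 := hnonneg _ h0.ge
    have h2 := hnonneg (g * (t ^ dvrOrd R g)⁻¹)⁻¹ (by rw [dvrOrd_inv, h0, neg_zero])
    rw [map_inv, dvrOrd_inv] at h2
    rw [map_mul, map_inv, map_zpow, dvrOrd_mul, dvrOrd_inv, dvrOrd_zpow] at h1 h2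
    linarith
  obtain ⟨g, hg⟩ := exists_dvrOrd_eq_one S (K := L)
  obtain ⟨k, hk⟩ := hφ g
  have hk0 : k ≠ 0 := by
    rintro rfl
    exact g.ne_zero (by rw [← hk, map_zero])
  have hg' : Units.map φ.toMonoidHom (Units.mk0 k hk0) = g := Units.ext hk
  have h1 := key (Units.mk0 k hk0)
  rw [hg', hg] at h1
  have h2 := hnonneg t (by omega)
  have h3 : dvrOrd S (Units.map φ.toMonoidHom t) = 1 :=
    (Int.eq_one_or_neg_one_of_mul_eq_one' h1.symm).elim And.right fun h => by omega
  rw [key, h3, mul_one]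

end Ord
/-! ### Rational functions and their orders on an integral scheme -/

section OrdAt

variable {X Y : Scheme.{u}} [IsIntegral X] [IsIntegral Y]

open Classical in
/-- The order of a rational function at a point whose local ring is a discrete valuation ring, and
zero at the other points. -/
noncomputable def ordAt (x : X) (f : X.functionFieldˣ) : ℤ :=
  if _ : IsDiscreteValuationRing (X.presheaf.stalk x) then dvrOrd (X.presheaf.stalk x) f else 0

theorem ordAt_eq_dvrOrd (x : X) [h : IsDiscreteValuationRing (X.presheaf.stalk x)]
    (f : X.functionFieldˣ) : ordAt x f = dvrOrd (X.presheaf.stalk x) f :=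
  dif_pos h

theorem ordAt_mul (x : X) (f g : X.functionFieldˣ) :
    ordAt x (f * g) = ordAt x f + ordAt x g := by
  unfold ordAt
  split_ifs
  · exact dvrOrd_mul _ f g
  · rfl

theorem ordAt_one (x : X) : ordAt x 1 = 0 := by
  have := ordAt_mul x 1 1
  rw [mul_one] at this
  omega

theorem ordAt_inv (x : X) (f : X.functionFieldˣ) : ordAt x f⁻¹ = -ordAt x f := by
  have := ordAt_mul x f f⁻¹
  rw [mul_inv_cancel, ordAt_one] at this
  omega

theorem ordAt_div (x : X) (f g : X.functionFieldˣ) :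
    ordAt x (f / g) = ordAt x f - ordAt x g := by
  rw [div_eq_mul_inv, ordAt_mul, ordAt_inv, sub_eq_add_neg]

theorem ordAt_zpow (x : X) (f : X.functionFieldˣ) (n : ℤ) :
    ordAt x (f ^ n) = n * ordAt x f := by
  unfold ordAt
  split_ifs
  · exact dvrOrd_zpow _ f n
  · rw [mul_zero]

theorem ne_genericPoint_of_isDiscreteValuationRing (x : X)
    [IsDiscreteValuationRing (X.presheaf.stalk x)] : x ≠ genericPoint X := by
  intro e
  refine IsDiscreteValuationRing.not_isField (X.presheaf.stalk x)
    (isField_stalk_of_closure_mem_irreducibleComponents X x ?_)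
  rw [e]
  simp [irreducibleComponents_eq_singleton]

theorem ordAt_eq_zero_of_mem {x : X} {f : X.functionFieldˣ} (h : f ∈ unitsAt x) :
    ordAt x f = 0 := by
  unfold ordAt
  split_ifs
  · exact (dvrOrd_eq_zero_iff _ f).mpr h
  · rfl

theorem ordAt_eq_zero_iff {x : X}
    (hx : IsDiscreteValuationRing (X.presheaf.stalk x) ∨ x = genericPoint X)
    (f : X.functionFieldˣ) : ordAt x f = 0 ↔ f ∈ unitsAt x := by
  refine ⟨fun h => ?_, ordAt_eq_zero_of_mem⟩
  obtain hx | rfl := hx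
  · rw [ordAt_eq_dvrOrd] at h
    exact (dvrOrd_eq_zero_iff _ f).mp h
  · exact mem_unitsAt_genericPoint f

theorem funMap_mem_range (f : X ⟶ Y) (hf : f (genericPoint X) = genericPoint Y) {x : X}
    {a : Y.functionField} (ha : a ∈ (algebraMap (Y.presheaf.stalk (f x)) Y.functionField).range) :
    funMap f hf a ∈ (algebraMap (X.presheaf.stalk x) X.functionField).range := by
  obtain ⟨a, rfl⟩ := ha
  obtain ⟨U, hU, s, rfl⟩ := Y.presheaf.exists_germ_eq a
  have hx : x ∈ f ⁻¹ᵁ U := hU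
  rw [algebraMap_germ, funMap_germ f hf _ (genericPoint_mem hx) le_rfl]
  exact ⟨_, algebraMap_germ hx _⟩

theorem ordAt_ratPull (f : X ⟶ Y) (hf : f (genericPoint X) = genericPoint Y)
    (hs : Function.Surjective (funMap f hf)) (x : X)
    (hx : IsDiscreteValuationRing (X.presheaf.stalk x) ↔
      IsDiscreteValuationRing (Y.presheaf.stalk (f x))) (k : Y.functionFieldˣ) :
    ordAt x (ratPull f hf k) = ordAt (f x) k := by
  by_cases h : IsDiscreteValuationRing (X.presheaf.stalk x)
  · have := hx.mp h
    rw [ordAt_eq_dvrOrd, ordAt_eq_dvrOrd]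
    exact dvrOrd_map _ _ (funMap f hf) hs (fun a ha => funMap_mem_range f hf ha) k
  · rw [ordAt, ordAt, dif_neg h, dif_neg (mt hx.mpr h)]

end OrdAt

section Separated

variable {X Y : Scheme.{u}} [IsIntegral X]

/-- Distinct points of an integral separated scheme have distinct local rings. -/
theorem eq_of_range_algebraMap_eq [X.IsSeparated] {x y : X}
    (h : (algebraMap (X.presheaf.stalk x) X.functionField).range =
      (algebraMap (X.presheaf.stalk y) X.functionField).range) : x = y := by
  have hxi := IsFractionRing.injective (X.presheaf.stalk x) X.functionField
  have hyi := IsFractionRing.injective (X.presheaf.stalk y) X.functionField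
  let ex := RingEquiv.ofBijective (algebraMap (X.presheaf.stalk x) X.functionField).rangeRestrict
    ⟨fun _ _ h => hxi (congrArg Subtype.val h), RingHom.rangeRestrict_surjective _⟩
  let ey := RingEquiv.ofBijective (algebraMap (X.presheaf.stalk y) X.functionField).rangeRestrict
    ⟨fun _ _ h => hyi (congrArg Subtype.val h), RingHom.rangeRestrict_surjective _⟩
  let e : X.presheaf.stalk x ≃+* X.presheaf.stalk y :=
    ex.trans ((RingEquiv.subringCongr h).trans ey.symm)
  have he : ∀ a, algebraMap (X.presheaf.stalk y) X.functionField (e a) =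
      algebraMap (X.presheaf.stalk x) X.functionField a := fun a =>
    congrArg Subtype.val (ey.apply_symm_apply (RingEquiv.subringCongr h (ex a)))
  let φ : X.presheaf.stalk x ⟶ X.presheaf.stalk y := CommRingCat.ofHom e.toRingHom
  let ι := X.presheaf.stalkSpecializes ((genericPoint_spec X).specializes (trivial : y ∈ ⊤))
  have hφ : φ ≫ ι = X.presheaf.stalkSpecializes
      ((genericPoint_spec X).specializes (trivial : x ∈ ⊤)) := by
    ext a
    exact he a
  have hdom : IsDominant (Spec.map ι) := by
    refine ⟨PrimeSpectrum.denseRange_comap_iff_ker_le_nilRadical _ |>.mpr ?_⟩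
    rw [(RingHom.injective_iff_ker_eq_bot ι.hom).mp hyi]
    exact bot_le
  have hmaps : Spec.map φ ≫ X.fromSpecStalk x = X.fromSpecStalk y := by
    apply ext_of_isDominant (Spec.map ι)
    rw [← Category.assoc, ← Spec.map_comp, hφ, Scheme.SpecMap_stalkSpecializes_fromSpecStalk,
      Scheme.SpecMap_stalkSpecializes_fromSpecStalk]
  have : IsLocalHom φ.hom := ⟨fun a ha => (isLocalHom_equiv e).map_nonunit a ha⟩
  have hc : Spec.map φ (IsLocalRing.closedPoint (X.presheaf.stalk y)) =
      IsLocalRing.closedPoint (X.presheaf.stalk x) := IsLocalRing.comap_closedPoint φ.hom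
  have hx : (Spec.map φ ≫ X.fromSpecStalk x) (IsLocalRing.closedPoint (X.presheaf.stalk y)) = x :=
    (congrArg (X.fromSpecStalk x) hc).trans Scheme.fromSpecStalk_closedPoint
  rw [← hx, hmaps]
  exact Scheme.fromSpecStalk_closedPoint

/-- An endomorphism of an integral separated scheme which is the identity on the function field is
the identity. -/
theorem eq_id_of_funMap_eq_id [X.IsSeparated] (σ : X ⟶ X)
    (hσ : σ (genericPoint X) = genericPoint X) (h : funMap σ hσ = RingHom.id _) : σ = 𝟙 X := by
  have hdom : IsDominant (X.fromSpecStalk (genericPoint X)) := by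
    refine ⟨dense_iff_closure_eq.mpr ?_⟩
    rw [← Set.univ_subset_iff, ← (genericPoint_spec X : closure _ = _)]
    refine closure_mono (Set.singleton_subset_iff.mpr ?_)
    rw [Scheme.range_fromSpecStalk]
    exact specializes_rfl
  apply ext_of_isDominant (X.fromSpecStalk (genericPoint X))
  rw [← Scheme.SpecMap_stalkMap_fromSpecStalk,
    ← Scheme.SpecMap_stalkSpecializes_fromSpecStalk (specializes_of_eq hσ), ← Category.assoc,
    ← Spec.map_comp]
  have h' : X.presheaf.stalkSpecializes (specializes_of_eq hσ) ≫ σ.stalkMap (genericPoint X) =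
    𝟙 _ := CommRingCat.hom_ext h
  rw [h', Spec.map_id]
  simp

end Separated
/-! ### Geometry of a smooth projective curve -/

section CurveFacts

variable {C : Scheme.{0}} [C.Over (Spec (.of ℂ))]

variable (C) in
/-- The structure map `ℂ → Γ(C, 𝒪_C)`. -/
noncomputable def constSection : CommRingCat.of ℂ ⟶ Γ(C, ⊤) :=
  (Scheme.ΓSpecIso (.of ℂ)).inv ≫ (C ↘ Spec (.of ℂ)).appTop

theorem fromSpecStalk_over (x : C) : C.fromSpecStalk x ≫ (C ↘ Spec (.of ℂ)) =
    Spec.map (constSection C ≫ C.presheaf.germ ⊤ x trivial) := by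
  rw [Spec.map_comp, constSection, Spec.map_comp, ← Scheme.fromSpecStalk_toSpecΓ, Category.assoc,
    ← Scheme.toSpecΓ_naturality_assoc, toSpecΓ_SpecMap_ΓSpecIso_inv, Category.comp_id]

variable [IsSmoothProjectiveCurve C]

instance : C.IsSeparated := by
  have : IsSeparated ((C ↘ Spec (.of ℂ)) ≫ Limits.terminal.from _) := inferInstance
  rw [Limits.terminal.comp_from] at this
  exact ⟨this⟩

instance : IsLocallyNoetherian C := LocallyOfFiniteType.isLocallyNoetherian (C ↘ Spec (.of ℂ))

instance : CompactSpace C :=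
  (quasiCompact_iff_compactSpace (C ↘ Spec (.of ℂ))).mp inferInstance

instance : IsNoetherian C where

theorem isClosed_or_eq_genericPoint (x : C) : IsClosed {x} ∨ x = genericPoint C := by
  obtain ⟨r, hr, hrc⟩ := (isClosed_closure (s := {x})).exists_closed_singleton
    ⟨x, subset_closure rfl⟩
  have hxr : x ⤳ r := specializes_iff_mem_closure.mpr hr
  have := isDiscreteValuationRing_stalk C r hrc
  obtain ⟨p, rfl⟩ : x ∈ Set.range (C.fromSpecStalk r) := by
    rw [Scheme.range_fromSpecStalk]; exact hxr
  obtain ⟨q, hq⟩ : genericPoint C ∈ Set.range (C.fromSpecStalk r) := by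
    rw [Scheme.range_fromSpecStalk]; exact (genericPoint_spec C).specializes trivial
  by_cases hp : p.asIdeal = ⊥
  · right
    have hpq : p ⤳ q := (PrimeSpectrum.le_iff_specializes p q).mp
      (show p.asIdeal ≤ q.asIdeal by rw [hp]; exact bot_le)
    have h1 := hpq.map (C.fromSpecStalk r).continuous
    rw [hq] at h1
    exact (h1.antisymm ((genericPoint_spec C).specializes trivial)).eq
  · left
    have hpm : p = IsLocalRing.closedPoint (C.presheaf.stalk r) :=
      PrimeSpectrum.ext (IsLocalRing.eq_maximalIdeal (Ring.DimensionLEOne.maximalOfPrime hp p.2))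
    rw [hpm, Scheme.fromSpecStalk_closedPoint]
    exact hrc

theorem isDiscreteValuationRing_stalk_iff (x : C) :
    IsDiscreteValuationRing (C.presheaf.stalk x) ↔ IsClosed {x} := by
  exact ⟨fun _ => (isClosed_or_eq_genericPoint x).resolve_right
    (ne_genericPoint_of_isDiscreteValuationRing x), isDiscreteValuationRing_stalk C x⟩

theorem ordAt_eq_zero (x : C) (f : C.functionFieldˣ) : ordAt x f = 0 ↔ f ∈ unitsAt x :=
  ordAt_eq_zero_iff ((isClosed_or_eq_genericPoint x).imp_left (isDiscreteValuationRing_stalk C x)) f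

/-- The complement of a nonempty open subset of a curve is finite. -/
theorem finite_compl_of_isOpen {U : Set C} (hU : IsOpen U) (hη : genericPoint C ∈ U) :
    Uᶜ.Finite := by
  obtain ⟨S, hS, hSc, hSi, hUS⟩ :=
    NoetherianSpace.exists_finite_set_isClosed_irreducible hU.isClosed_compl
  rw [hUS]
  refine hS.sUnion fun t ht => ?_
  obtain ⟨x, hx⟩ := QuasiSober.sober (hSi t ht) (hSc t ht)
  have hxU : x ∈ Uᶜ := by
    rw [hUS]
    exact ⟨t, ht, hx.mem⟩
  have hxc : IsClosed {x} := (isClosed_or_eq_genericPoint x).resolve_right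
    fun h => hxU (h ▸ hη)
  rw [← hx, hxc.closure_eq]
  exact Set.finite_singleton x

/-- Weak approximation at two closed points. -/
theorem exists_ordAt_eq_one_and_eq_zero {x y : C} (hx : IsClosed {x}) (hy : IsClosed {y})
    (hxy : x ≠ y) : ∃ f : C.functionFieldˣ, ordAt x f = 1 ∧ ordAt y f = 0 := by
  have := isDiscreteValuationRing_stalk C x hx
  have := isDiscreteValuationRing_stalk C y hy
  simp only [ordAt_eq_dvrOrd]
  exact exists_dvrOrd_eq_one_and_eq_zero _ _ (mt eq_of_range_algebraMap_eq hxy)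

theorem exists_ordAt_eq_one {x : C} (hx : IsClosed {x}) :
    ∃ f : C.functionFieldˣ, ordAt x f = 1 := by
  have := isDiscreteValuationRing_stalk C x hx
  simp only [ordAt_eq_dvrOrd]
  exact exists_dvrOrd_eq_one _

variable (C) in
/-- The constants in the function field of `C`. -/
noncomputable def constFun : ℂ →+* C.functionField :=
  (constSection C ≫ C.presheaf.germ ⊤ (genericPoint C) trivial).hom

theorem constSection_surjective : Function.Surjective (constSection C).hom := by
  have hint : (constSection C).hom.IsIntegral := by
    apply RingHom.isIntegral_respectsIso.2 (e := (Scheme.ΓSpecIso _).symm.commRingCatIsoToRingEquiv)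
    exact isIntegral_appTop_of_universallyClosed (C ↘ Spec (.of ℂ))
  exact (IsAlgClosed.ringHom_bijective_of_isIntegral _ hint).2

theorem exists_constFun_eq {f : C.functionFieldˣ} (h : ∀ x, f ∈ unitsAt x) :
    ∃ c, constFun C c = f := by
  obtain ⟨s, hs⟩ := exists_ratUnit_eq (U := ⊤) trivial f fun x _ => h x
  obtain ⟨c, hc⟩ := constSection_surjective (s : Γ(C, ⊤))
  refine ⟨c, ?_⟩
  rw [← hs]
  exact congrArg (C.presheaf.germ ⊤ (genericPoint C) trivial) hc

theorem constFun_mem_unitsAt {c : ℂ} {f : C.functionFieldˣ} (h : constFun C c = f) (x : C) :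
    f ∈ unitsAt x := by
  have hc : c ≠ 0 := by
    rintro rfl
    exact f.ne_zero (by rw [← h, map_zero])
  have := ratUnit_mem_unitsAt (U := ⊤) (x := x) trivial trivial
    (Units.map (constSection C).hom.toMonoidHom (Units.mk0 c hc))
  convert this
  exact Units.ext h.symm

/-- A regular function at a closed point is a constant up to the maximal ideal. -/
theorem exists_sub_constFun_mem (x : C) (hx : IsClosed {x}) (a : C.presheaf.stalk x) :
    ∃ c : ℂ, a - C.presheaf.germ ⊤ x trivial ((constSection C).hom c) ∈
      IsLocalRing.maximalIdeal (C.presheaf.stalk x) := by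
  have h : (constSection C ≫ C.presheaf.germ ⊤ x trivial) ≫ C.residue x =
      (residueFieldIsoBase (C ↘ Spec (.of ℂ)) x hx).inv := by
    apply Spec.map_injective
    rw [SpecMap_residueFieldIsoBase_inv, Spec.map_comp, ← fromSpecStalk_over, ← Category.assoc]
    rfl
  refine ⟨(residueFieldIsoBase (C ↘ Spec (.of ℂ)) x hx).hom (C.residue x a), ?_⟩
  rw [← IsLocalRing.residue_eq_zero_iff, map_sub, sub_eq_zero]
  have h2 := congrArg (fun φ => φ.hom
    ((residueFieldIsoBase (C ↘ Spec (.of ℂ)) x hx).hom (C.residue x a))) h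
  refine Eq.trans ?_ h2.symm
  exact (congrArg (fun φ => φ.hom (C.residue x a))
    (residueFieldIsoBase (C ↘ Spec (.of ℂ)) x hx).hom_inv_id).symm

theorem ordAt_pos_of_mem {x : C} (hx : IsClosed {x}) {a : C.presheaf.stalk x}
    (ha : a ∈ IsLocalRing.maximalIdeal (C.presheaf.stalk x)) {f : C.functionFieldˣ}
    (hf : algebraMap (C.presheaf.stalk x) C.functionField a = f) : 0 < ordAt x f := by
  have := isDiscreteValuationRing_stalk C x hx
  rw [ordAt_eq_dvrOrd]
  refine lt_of_le_of_ne ((dvrOrd_nonneg_iff _ f).mpr ⟨a, hf⟩) fun h => ?_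
  obtain ⟨u, hu⟩ := (dvrOrd_eq_zero_iff _ f).mp h.symm
  have : (u : C.presheaf.stalk x) = a := by
    apply IsFractionRing.injective (C.presheaf.stalk x) C.functionField
    rw [hf, ← hu]
    rfl
  exact (IsLocalRing.mem_maximalIdeal _).mp ha (this ▸ u.isUnit)

theorem ordAt_add {x : C} (hx : IsClosed {x}) {f g h : C.functionFieldˣ}
    (e : (f : C.functionField) + g = h) {n : ℤ} (hf : n ≤ ordAt x f) (hg : n ≤ ordAt x g) :
    n ≤ ordAt x h := by
  have := isDiscreteValuationRing_stalk C x hx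
  rw [ordAt_eq_dvrOrd] at *
  exact dvrOrd_add _ e hf hg

end CurveFacts
/-! ### Divisors of line bundles on a curve -/

section Divisor

variable {C : Scheme.{0}} [C.Over (Spec (.of ℂ))] [IsSmoothProjectiveCurve C]

/-- `P` is the class of the line bundle of the divisor `D`. -/
def Pic.HasDivisor (P : Pic C) (D : C → ℤ) : Prop :=
  ∃ g, P.HasEquations g ∧ ∀ x, ordAt x (g x) = D x

namespace Pic

theorem exists_hasDivisor (P : Pic C) : ∃ D, P.HasDivisor D := by
  obtain ⟨g, hg⟩ := P.exists_hasEquations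
  exact ⟨_, g, hg, fun _ => rfl⟩

theorem HasDivisor.add {P Q : Pic C} {D E : C → ℤ} (hP : P.HasDivisor D) (hQ : Q.HasDivisor E) :
    (P + Q).HasDivisor (D + E) := by
  obtain ⟨g, hg, hD⟩ := hP
  obtain ⟨k, hk, hE⟩ := hQ
  exact ⟨_, hg.add hk, fun x => by rw [Pi.mul_apply, ordAt_mul, hD, hE]; rfl⟩

theorem HasDivisor.neg {P : Pic C} {D : C → ℤ} (hP : P.HasDivisor D) : (-P).HasDivisor (-D) := by
  obtain ⟨g, hg, hD⟩ := hP
  exact ⟨_, hg.neg, fun x => by rw [Pi.inv_apply, ordAt_inv, hD]; rfl⟩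

theorem HasDivisor.sub {P Q : Pic C} {D E : C → ℤ} (hP : P.HasDivisor D) (hQ : Q.HasDivisor E) :
    (P - Q).HasDivisor (D - E) := by
  rw [sub_eq_add_neg, sub_eq_add_neg]
  exact hP.add hQ.neg

theorem HasDivisor.eq_iff {P Q : Pic C} {D E : C → ℤ} (hP : P.HasDivisor D)
    (hQ : Q.HasDivisor E) : P = Q ↔ ∃ f : C.functionFieldˣ, ∀ x, E x + ordAt x f = D x := by
  obtain ⟨g, hg, hD⟩ := hP
  obtain ⟨k, hk, hE⟩ := hQ
  refine (hg.eq_iff hk).trans (exists_congr fun f => forall_congr' fun x => ?_)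
  rw [← ordAt_eq_zero, ordAt_div, ordAt_mul, hD, hE, sub_eq_zero]

theorem HasDivisor.eq {P Q : Pic C} {D : C → ℤ} (hP : P.HasDivisor D) (hQ : Q.HasDivisor D) :
    P = Q :=
  (hP.eq_iff hQ).mpr ⟨1, fun x => by rw [ordAt_one, add_zero]⟩

theorem HasDivisor.add_ordAt {P : Pic C} {D : C → ℤ} (hP : P.HasDivisor D)
    (f : C.functionFieldˣ) : P.HasDivisor fun x => D x + ordAt x f := by
  obtain ⟨g, hg, hD⟩ := hP
  exact ⟨_, hg.mul_const f, fun x => by rw [ordAt_mul, hD]⟩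

theorem hasDivisor_zero : (0 : Pic C).HasDivisor 0 := by
  obtain ⟨D, hD⟩ := exists_hasDivisor (0 : Pic C)
  simpa using hD.sub hD

open Classical in
theorem hasDivisor_pointBundle (r : C) (hr : IsClosed {r}) :
    (Pic.mk (pointBundle C r hr)).HasDivisor (Pi.single r 1) := by
  have := isDiscreteValuationRing_stalk C r hr
  have hm := IsDiscreteValuationRing.not_a_field (C.presheaf.stalk r)
  set E := (nonempty_localEquations C r hr).some with hE
  have hne : ∀ x, C.presheaf.germ (E.nhd x) (genericPoint C) (genericPoint_mem (E.mem_nhd x))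
      (E.eqn x) ≠ 0 := fun x => (E.isLocalEquation x).germ_ne_zero hm _ _
  refine ⟨fun x => Units.mk0 _ (hne x), ⟨_, _, rfl,
    E.isRationalSection hm fun x => rfl, fun x => by rw [div_self']; exact one_mem _⟩, fun x => ?_⟩
  obtain rfl | hx := eq_or_ne x r
  · rw [Pi.single_eq_same, ordAt_eq_dvrOrd]
    exact dvrOrd_eq_one _ ((E.isLocalEquation x).span_eq (E.mem_nhd x))
      (algebraMap_germ (E.mem_nhd x) _).symm
  · rw [Pi.single_eq_of_ne hx]
    apply ordAt_eq_zero_of_mem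
    obtain ⟨u, hu⟩ := (E.isLocalEquation x).isUnit x (E.mem_nhd x) hx
    refine ⟨u, Units.ext ?_⟩
    exact (congrArg _ hu).trans (algebraMap_germ (E.mem_nhd x) _)

end Pic

end Divisor

/-! ### Involutions of a curve -/

section Invol

variable {C : Scheme.{0}} {σ : C ⟶ C}

theorem involution_apply (hσ : σ ≫ σ = 𝟙 C) (x : C) : σ (σ x) = x :=
  congrArg (fun f : C ⟶ C => f x) hσ

theorem involution_isClosed_iff (hσ : σ ≫ σ = 𝟙 C) (x : C) :
    IsClosed {σ x} ↔ IsClosed {x} := by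
  have key : ∀ y : C, IsClosed {y} → IsClosed {σ y} := by
    intro y hy
    have : {σ y} = σ ⁻¹' {y} := by
      ext z
      constructor
      · rintro rfl; exact involution_apply hσ y
      · intro hz
        have hz : σ z = y := hz
        rw [Set.mem_singleton_iff, ← hz, involution_apply hσ]
    rw [this]
    exact hy.preimage σ.continuous
  refine ⟨fun h => ?_, key x⟩
  have := key _ h
  rwa [involution_apply hσ] at this

variable [IsIntegral C]

theorem involution_genericPoint (hσ : σ ≫ σ = 𝟙 C) : σ (genericPoint C) = genericPoint C :=
  have : IsIso σ := ⟨σ, hσ, hσ⟩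
  genericPoint_eq_of_isOpenImmersion σ

/-- The action of an involution on the nonzero rational functions. -/
noncomputable def ratConj (hσ : σ ≫ σ = 𝟙 C) : C.functionFieldˣ →* C.functionFieldˣ :=
  ratPull σ (involution_genericPoint hσ)

theorem funMap_congr {X Y : Scheme.{u}} [IsIntegral X] [IsIntegral Y] {f g : X ⟶ Y} (h : f = g)
    (hf : f (genericPoint X) = genericPoint Y) (hg : g (genericPoint X) = genericPoint Y) :
    funMap f hf = funMap g hg := by
  subst h
  rfl

theorem funMap_involution (hσ : σ ≫ σ = 𝟙 C) (a : C.functionField) :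
    funMap σ (involution_genericPoint hσ) (funMap σ (involution_genericPoint hσ) a) = a := by
  have hid : (𝟙 C : C ⟶ C) (genericPoint C) = genericPoint C := rfl
  have h := funMap_comp σ σ (involution_genericPoint hσ) (involution_genericPoint hσ)
    (by rw [hσ, hid])
  rw [funMap_congr hσ _ hid, funMap_id] at h
  exact congrArg (fun φ : C.functionField →+* C.functionField => φ a) h

theorem ratConj_ratConj (hσ : σ ≫ σ = 𝟙 C) (f : C.functionFieldˣ) :
    ratConj hσ (ratConj hσ f) = f :=
  Units.ext (funMap_involution hσ _)

theorem coe_ratConj (hσ : σ ≫ σ = 𝟙 C) (f : C.functionFieldˣ) :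
    (ratConj hσ f : C.functionField) = funMap σ (involution_genericPoint hσ) f := rfl

end Invol

section CurveInvol

variable {C : Scheme.{0}} [C.Over (Spec (.of ℂ))] [IsSmoothProjectiveCurve C] {σ : C ⟶ C}

theorem ordAt_ratConj (hσ : σ ≫ σ = 𝟙 C) (x : C) (f : C.functionFieldˣ) :
    ordAt x (ratConj hσ f) = ordAt (σ x) f :=
  ordAt_ratPull σ _ (fun a => ⟨_, funMap_involution hσ a⟩) x
    (by rw [isDiscreteValuationRing_stalk_iff, isDiscreteValuationRing_stalk_iff,
      involution_isClosed_iff hσ]) f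

theorem Pic.HasDivisor.involution (hσ : σ ≫ σ = 𝟙 C) {P : Pic C} {D : C → ℤ}
    (hP : P.HasDivisor D) : (Pic.pullback σ P).HasDivisor fun x => D (σ x) := by
  obtain ⟨g, hg, hD⟩ := hP
  exact ⟨_, hg.pullback σ (involution_genericPoint hσ), fun x =>
    (ordAt_ratConj hσ x _).trans (hD _)⟩

theorem ordAt_neg (x : C) (f : C.functionFieldˣ) : ordAt x (-f) = ordAt x f := by
  have h : ordAt x (-1 : C.functionFieldˣ) = 0 :=
    ordAt_eq_zero_of_mem (constFun_mem_unitsAt (c := -1) (by simp) x)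
  rw [← neg_one_mul, ordAt_mul, h, zero_add]

theorem exists_ratConj_eq_neg (hσ : σ ≫ σ = 𝟙 C) (hσ' : σ ≠ 𝟙 C) :
    ∃ w : C.functionFieldˣ, ratConj hσ w = -w := by
  obtain ⟨a, ha⟩ : ∃ a, a - funMap σ (involution_genericPoint hσ) a ≠ 0 := by
    by_contra! h
    exact hσ' (eq_id_of_funMap_eq_id σ (involution_genericPoint hσ)
      (RingHom.ext fun a => (sub_eq_zero.mp (h a)).symm))
  refine ⟨Units.mk0 _ ha, Units.ext ?_⟩
  rw [coe_ratConj, Units.val_neg, Units.val_mk0, map_sub, funMap_involution hσ, neg_sub]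

theorem div_zpow_ordAt_mem_unitsAt {r : C} {t f : C.functionFieldˣ} (ht : ordAt r t = 1) :
    f / t ^ ordAt r f ∈ unitsAt r := by
  rw [← ordAt_eq_zero, ordAt_div, ordAt_zpow, ht, mul_one, sub_self]

variable [σ.IsOver (Spec (.of ℂ))]

theorem funMap_constFun (hσ : σ ≫ σ = 𝟙 C) (c : ℂ) :
    funMap σ (involution_genericPoint hσ) (constFun C c) = constFun C c := by
  have h : constSection C ≫ σ.appTop = constSection C := by
    rw [constSection, Category.assoc, ← Scheme.Hom.comp_appTop, comp_over]
  refine (funMap_germ σ (involution_genericPoint hσ) (U := ⊤) trivial (V := ⊤) trivial le_top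
    ((constSection C).hom c)).trans ?_
  refine congrArg (C.presheaf.germ ⊤ (genericPoint C) trivial) ?_
  exact (congrArg (fun φ => φ.hom ((constSection C).hom c))
    (Scheme.Hom.app_eq_appLE σ (U := ⊤)).symm).trans (congrArg (fun φ => φ.hom c) h)

theorem ratConj_ne_neg_of_mem_unitsAt (hσ : σ ≫ σ = 𝟙 C) {r : C} (hr : r ∈ fixedLocus σ)
    {v : C.functionFieldˣ} (hv : v ∈ unitsAt r) : ratConj hσ v ≠ -v := by
  intro h
  obtain ⟨a, ha⟩ := id hv
  obtain ⟨c, hc⟩ := exists_sub_constFun_mem r hr.1 (a : C.presheaf.stalk r)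
  have hval : algebraMap (C.presheaf.stalk r) C.functionField
      (a - C.presheaf.germ ⊤ r trivial ((constSection C).hom c)) = v - constFun C c := by
    rw [map_sub, ← ha]
    exact congrArg (_ - ·) (algebraMap_germ (U := ⊤) (x := r) trivial _)
  have hc0 : c ≠ 0 := by
    rintro rfl
    have := ordAt_pos_of_mem hr.1 hc (f := v) (by rw [hval, map_zero, sub_zero])
    rw [ordAt_eq_zero_of_mem hv] at this
    omega
  have hC0 : constFun C c ≠ 0 := (map_ne_zero _).mpr hc0
  have hconj : funMap σ (involution_genericPoint hσ) (v - constFun C c) = -v - constFun C c := by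
    rw [map_sub, funMap_constFun hσ, ← coe_ratConj hσ, h, Units.val_neg]
  by_cases hw : (v : C.functionField) - constFun C c = 0
  · rw [hw, map_zero] at hconj
    have h2 : 2 * constFun C c = 0 := by linear_combination hconj - hw
    exact hC0 ((mul_eq_zero.mp h2).resolve_left
      (by rw [← map_ofNat (constFun C) 2]; exact (map_ne_zero _).mpr two_ne_zero))
  · have hpos := ordAt_pos_of_mem hr.1 hc (f := Units.mk0 _ hw) hval
    have hpos' : 1 ≤ ordAt r (ratConj hσ (Units.mk0 _ hw)) := by
      rw [ordAt_ratConj, hr.2]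
      exact hpos
    have h2c : constFun C (-2 * c) ≠ 0 := (map_ne_zero _).mpr (by simpa using hc0)
    have := ordAt_add hr.1 (h := Units.mk0 _ h2c) (n := 1) (by
      rw [coe_ratConj, Units.val_mk0, hconj, Units.val_mk0, map_mul, map_neg, map_ofNat]
      ring) hpos hpos'
    rw [ordAt_eq_zero_of_mem (constFun_mem_unitsAt rfl r)] at this
    omega

/-- At a fixed point, a nontrivial involution changes the sign of some local parameter. -/
theorem exists_ordAt_eq_one_and_ratConj_eq_neg (hσ : σ ≫ σ = 𝟙 C) (hσ' : σ ≠ 𝟙 C) {r : C}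
    (hr : r ∈ fixedLocus σ) : ∃ t : C.functionFieldˣ, ordAt r t = 1 ∧ ratConj hσ t = -t := by
  obtain ⟨w, hw⟩ := exists_ratConj_eq_neg hσ hσ'
  have hne : ∀ t : C.functionFieldˣ, ordAt r t = 1 → ratConj hσ t ≠ t := by
    intro t ht h
    refine ratConj_ne_neg_of_mem_unitsAt hσ hr (div_zpow_ordAt_mem_unitsAt (f := w) ht) ?_
    rw [map_div, map_zpow, h, hw, neg_div]
  obtain ⟨t, ht⟩ := exists_ordAt_eq_one hr.1
  set s := funMap σ (involution_genericPoint hσ) with hs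
  have ht' : ordAt r (ratConj hσ t) = 1 := by rw [ordAt_ratConj, hr.2, ht]
  have hq : (t : C.functionField) - s t ≠ 0 := fun h =>
    hne t ht (Units.ext (sub_eq_zero.mp h).symm)
  have hqc : ratConj hσ (Units.mk0 _ hq) = -Units.mk0 _ hq := by
    ext
    rw [coe_ratConj, ← hs, Units.val_neg, Units.val_mk0, map_sub, hs, funMap_involution hσ, neg_sub]
  by_cases hp : (t : C.functionField) + s t = 0
  · exact ⟨t, ht, Units.ext (by rw [coe_ratConj, Units.val_neg]; linear_combination hp)⟩
  have hpc : ratConj hσ (Units.mk0 _ hp) = Units.mk0 _ hp := by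
    ext
    rw [coe_ratConj, ← hs, Units.val_mk0, map_add, hs, funMap_involution hσ, add_comm]
  have hp1 : 1 ≤ ordAt r (Units.mk0 _ hp) :=
    ordAt_add hr.1 (f := t) (g := ratConj hσ t) rfl ht.ge ht'.ge
  have hq1 : 1 ≤ ordAt r (Units.mk0 _ hq) :=
    ordAt_add hr.1 (f := t) (g := -ratConj hσ t)
      (by rw [Units.val_neg, ← sub_eq_add_neg]; rfl) ht.ge (by rw [ordAt_neg]; exact ht'.ge)
  refine ⟨Units.mk0 _ hq, ?_, hqc⟩
  by_contra hq2
  have hp2 : ordAt r (Units.mk0 _ hp) ≠ 1 := fun h => hne _ h hpc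
  have h20 : constFun C 2 ≠ 0 := (map_ne_zero _).mpr two_ne_zero
  have h2 := ordAt_add hr.1 (f := Units.mk0 _ hp) (g := Units.mk0 _ hq)
    (h := Units.mk0 _ h20 * t) (n := 2) (by
      rw [Units.val_mul, Units.val_mk0, Units.val_mk0, Units.val_mk0, map_ofNat]
      ring) (by omega) (by omega)
  rw [ordAt_mul, ordAt_eq_zero_of_mem (constFun_mem_unitsAt rfl r), ht] at h2
  omega

theorem odd_ordAt_of_ratConj_eq_neg (hσ : σ ≫ σ = 𝟙 C) (hσ' : σ ≠ 𝟙 C) {r : C}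
    (hr : r ∈ fixedLocus σ) {f : C.functionFieldˣ} (hf : ratConj hσ f = -f) :
    Odd (ordAt r f) := by
  obtain ⟨t, ht, htc⟩ := exists_ordAt_eq_one_and_ratConj_eq_neg hσ hσ' hr
  by_contra h
  refine ratConj_ne_neg_of_mem_unitsAt hσ hr (div_zpow_ordAt_mem_unitsAt (f := f) ht) ?_
  rw [map_div, map_zpow, htc, hf, (Int.not_odd_iff_even.mp h).neg_zpow, neg_div]

theorem even_ordAt_of_ratConj_eq (hσ : σ ≫ σ = 𝟙 C) (hσ' : σ ≠ 𝟙 C) {r : C}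
    (hr : r ∈ fixedLocus σ) {f : C.functionFieldˣ} (hf : ratConj hσ f = f) :
    Even (ordAt r f) := by
  obtain ⟨t, ht, htc⟩ := exists_ordAt_eq_one_and_ratConj_eq_neg hσ hσ' hr
  by_contra h
  refine ratConj_ne_neg_of_mem_unitsAt hσ hr (div_zpow_ordAt_mem_unitsAt (f := f) ht) ?_
  rw [map_div, map_zpow, htc, hf, (Int.not_even_iff_odd.mp h).neg_zpow, div_neg]

theorem finite_fixedLocus (hσ : σ ≫ σ = 𝟙 C) (hσ' : σ ≠ 𝟙 C) : (fixedLocus σ).Finite := by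
  obtain ⟨w, hw⟩ := exists_ratConj_eq_neg hσ hσ'
  refine (finite_compl_of_isOpen (isOpen_mem_unitsAt w) (mem_unitsAt_genericPoint w)).subset
    fun r hr h => ?_
  have := odd_ordAt_of_ratConj_eq_neg hσ hσ' hr hw
  rw [ordAt_eq_zero_of_mem h] at this
  exact Int.not_odd_zero this

end CurveInvol
/-! ### The quotient of a curve by an involution -/

section Quotient

variable {C : Scheme.{0}} {σ : C ⟶ C} {B : Scheme.{0}} {π : C ⟶ B}

theorem IsQuotient.apply_involution (hπ : IsQuotient σ π) (x : C) : π (σ x) = π x :=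
  congrArg (fun f : C ⟶ B => f x) hπ.comm

theorem IsQuotient.surjective (hπ : IsQuotient σ π) : Function.Surjective π :=
  hπ.isQuotientMap.surjective

/-- Stable opens of `C` are preimages of opens of the quotient. -/
theorem IsQuotient.exists_opens (hπ : IsQuotient σ π) {W : Set C} (hW : IsOpen W)
    (hs : ∀ x ∈ W, σ x ∈ W) : ∃ V : B.Opens, ∀ x, π x ∈ V ↔ x ∈ W := by
  have h : π ⁻¹' (π '' W) = W := by
    refine Set.Subset.antisymm ?_ (Set.subset_preimage_image _ _)
    rintro x ⟨y, hy, hyx⟩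
    obtain rfl | rfl := hπ.orbit y x hyx
    · exact hy
    · exact hs y hy
  refine ⟨⟨π '' W, hπ.isQuotientMap.isOpen_preimage.mp (by rwa [h])⟩, fun x => ?_⟩
  exact Set.ext_iff.mp h x

variable [IsIntegral C]

theorem IsQuotient.isIntegral (hπ : IsQuotient σ π) : IsIntegral B where
  nonempty := ⟨π (genericPoint C)⟩
  component_integral U hU := by
    obtain ⟨⟨b, hb⟩⟩ := hU
    obtain ⟨x, rfl⟩ := hπ.surjective b
    have : Nonempty (π ⁻¹ᵁ U) := ⟨⟨x, hb⟩⟩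
    exact Function.Injective.isDomain (π.app U).hom (hπ.injective U)

theorem IsQuotient.apply_genericPoint [IsIntegral B] (hπ : IsQuotient σ π) :
    π (genericPoint C) = genericPoint B := by
  apply ((genericPoint_spec B).eq _).symm
  convert (genericPoint_spec C).image π.continuous
  rw [Set.image_univ, hπ.surjective.range_eq, closure_univ]

theorem ratConj_ratPull [IsIntegral B] (hσ : σ ≫ σ = 𝟙 C) (hπ : IsQuotient σ π)
    (k : B.functionFieldˣ) :
    ratConj hσ (ratPull π hπ.apply_genericPoint k) = ratPull π hπ.apply_genericPoint k := by
  have h := funMap_comp σ π (involution_genericPoint hσ) hπ.apply_genericPoint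
    (by rw [hπ.comm, hπ.apply_genericPoint])
  rw [funMap_congr hπ.comm _ hπ.apply_genericPoint] at h
  exact Units.ext (congrArg (fun φ : B.functionField →+* C.functionField => φ k) h)

theorem mem_unitsAt_of_involution (hσ : σ ≫ σ = 𝟙 C) {f : C.functionFieldˣ}
    (hf : ratConj hσ f = f) {x : C} (hx : f ∈ unitsAt x) : f ∈ unitsAt (σ x) := by
  rw [← hf]
  refine ratPull_mem_unitsAt σ _ ?_
  rwa [involution_apply hσ]

theorem IsQuotient.exists_app_eq [IsIntegral B] (hσ : σ ≫ σ = 𝟙 C) (hπ : IsQuotient σ π)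
    {f : C.functionFieldˣ} (hf : ratConj hσ f = f) {V : B.Opens}
    (hη : genericPoint C ∈ π ⁻¹ᵁ V) (s : Γ(C, π ⁻¹ᵁ V)ˣ) (hs : ratUnit hη s = f) :
    ∃ t : Γ(B, V), π.app V t = s := by
  have hle : π ⁻¹ᵁ V ≤ σ ⁻¹ᵁ (π ⁻¹ᵁ V) := fun x hx => by
    change π (σ x) ∈ V
    rw [hπ.apply_involution]
    exact hx
  refine hπ.invariant V hle s ?_
  apply germ_injective_of_isIntegral C _ hη
  rw [← funMap_germ σ (involution_genericPoint hσ) hη hη hle, ← coe_ratUnit, hs, ← coe_ratConj hσ, hf]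

/-- Invariant rational functions which are invertible along a fibre are invertible on the
quotient. -/
theorem IsQuotient.exists_ratPull_eq [IsIntegral B] (hσ : σ ≫ σ = 𝟙 C) (hπ : IsQuotient σ π)
    {f : C.functionFieldˣ} (hf : ratConj hσ f = f) (b : B) (hb : ∀ x, π x = b → f ∈ unitsAt x) :
    ∃ k ∈ unitsAt b, ratPull π hπ.apply_genericPoint k = f := by
  obtain ⟨V, hV⟩ := hπ.exists_opens (isOpen_mem_unitsAt f)
    fun x hx => mem_unitsAt_of_involution hσ hf hx
  have hbV : b ∈ V := by
    obtain ⟨x, rfl⟩ := hπ.surjective b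
    exact (hV x).mpr (hb x rfl)
  have hη : genericPoint C ∈ π ⁻¹ᵁ V := (hV _).mpr (mem_unitsAt_genericPoint f)
  obtain ⟨s, hs⟩ := exists_ratUnit_eq hη f fun x hx => (hV x).mp hx
  obtain ⟨t, ht⟩ := hπ.exists_app_eq hσ hf hη s hs
  obtain ⟨t', ht'⟩ := hπ.exists_app_eq hσ (f := f⁻¹) (by rw [map_inv, hf]) hη s⁻¹
    (by rw [map_inv, hs])
  have htt : t * t' = 1 := by
    apply hπ.injective V
    rw [map_mul, map_one, ht, ht', Units.mul_inv]
  have hηB : genericPoint B ∈ V := genericPoint_mem hbV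
  refine ⟨ratUnit hηB ⟨t, t', htt, by rw [mul_comm, htt]⟩, ratUnit_mem_unitsAt hbV _ _, ?_⟩
  rw [ratPull_ratUnit π hπ.apply_genericPoint hηB hη le_rfl, ← hs]
  congr 1
  ext
  change (π.appLE V (π ⁻¹ᵁ V) le_rfl).hom t = _
  rw [← Scheme.Hom.app_eq_appLE]
  exact ht

end Quotient

section Descent

variable {C : Scheme.{0}} [C.Over (Spec (.of ℂ))] [IsSmoothProjectiveCurve C] {σ : C ⟶ C}
  {B : Scheme.{0}} {π : C ⟶ B}

theorem exists_ratConj_eq_and_ordAt_eq (hσ : σ ≫ σ = 𝟙 C) {x : C} {n : ℤ}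
    (hc : IsClosed {x}) (hn : σ x = x → Even n) :
    ∃ h : C.functionFieldˣ, ratConj hσ h = h ∧ ordAt x h = n := by
  have hinv : ∀ t : C.functionFieldˣ, ratConj hσ (t * ratConj hσ t) = t * ratConj hσ t :=
    fun t => by rw [map_mul, ratConj_ratConj, mul_comm]
  by_cases hx : σ x = x
  · obtain ⟨k, rfl⟩ := hn hx
    obtain ⟨t, ht⟩ := exists_ordAt_eq_one hc
    refine ⟨(t * ratConj hσ t) ^ k, by rw [map_zpow, hinv], ?_⟩
    rw [ordAt_zpow, ordAt_mul, ordAt_ratConj, hx, ht]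
    ring
  · obtain ⟨t, ht, ht'⟩ := exists_ordAt_eq_one_and_eq_zero hc
      ((involution_isClosed_iff hσ x).mpr hc) (Ne.symm hx)
    refine ⟨(t * ratConj hσ t) ^ n, by rw [map_zpow, hinv], ?_⟩
    rw [ordAt_zpow, ordAt_mul, ordAt_ratConj, ht, ht']
    ring

/-- The line bundle of an invariant divisor with even multiplicities at the fixed points is the
pullback of a line bundle on the quotient. -/
theorem Pic.HasDivisor.mem_range_pullback (hσ : σ ≫ σ = 𝟙 C) (hπ : IsQuotient σ π) {P : Pic C}
    {D : C → ℤ} (hP : P.HasDivisor D) (hD : ∀ x, D (σ x) = D x)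
    (heven : ∀ r ∈ fixedLocus σ, Even (D r)) : P ∈ (Pic.pullback π).range := by
  have := hπ.isIntegral
  obtain ⟨g, hg, hgD⟩ := id hP
  have hex : ∀ b : B, ∃ h : C.functionFieldˣ, ratConj hσ h = h ∧
      ∀ x, π x = b → ordAt x h = D x := by
    intro b
    obtain ⟨x, rfl⟩ := hπ.surjective b
    obtain ⟨h, hh, hx⟩ : ∃ h : C.functionFieldˣ, ratConj hσ h = h ∧ ordAt x h = D x := by
      obtain hc | rfl := isClosed_or_eq_genericPoint x
      · exact exists_ratConj_eq_and_ordAt_eq hσ hc fun hx => heven x ⟨hc, hx⟩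
      · refine ⟨1, map_one _, ?_⟩
        rw [← hgD, ordAt_one, ordAt_eq_zero_of_mem (mem_unitsAt_genericPoint _)]
    refine ⟨h, hh, fun y hy => ?_⟩
    obtain rfl | rfl := hπ.orbit x y hy.symm
    · exact hx
    · rw [← ordAt_ratConj hσ, hh, hx, hD]
  choose h hh hord using hex
  have hgen : ∀ x, π x = genericPoint B → x = genericPoint C := by
    intro x hx
    rw [← hπ.apply_genericPoint] at hx
    obtain h | h := hπ.orbit _ _ hx.symm
    · exact h
    · rw [h, involution_genericPoint hσ]
  choose k _ hk using fun b => hπ.exists_ratPull_eq hσ (hh b) (genericPoint B)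
    fun x hx => hgen x hx ▸ mem_unitsAt_genericPoint _
  obtain ⟨M, hM⟩ := Pic.exists_hasEquations_of_isOpen (g := k) fun b => by
    obtain ⟨V, hV⟩ := hπ.exists_opens (hg.isOpen (h b)) fun x hx => by
      have hx : h b / g x ∈ unitsAt x := hx
      change h b / g (σ x) ∈ unitsAt (σ x)
      rw [← ordAt_eq_zero, ordAt_div, hgD] at hx ⊢
      rwa [hD, ← ordAt_ratConj hσ, hh]
    have hV' : ∀ x, π x ∈ V ↔ ordAt x (h b) = D x := fun x => by
      refine (hV x).trans ?_
      change h b / g x ∈ unitsAt x ↔ _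
      rw [← ordAt_eq_zero, ordAt_div, hgD, sub_eq_zero]
    refine ⟨V, ?_, fun b' hb' => ?_⟩
    · obtain ⟨x, hx⟩ := hπ.surjective b
      rw [← hx, hV' x]
      exact hord b x hx
    · obtain ⟨k', hk', e⟩ := hπ.exists_ratPull_eq hσ (f := h b' / h b)
        (by rw [map_div, hh, hh]) b' fun x hx => by
          rw [← ordAt_eq_zero, ordAt_div, hord b' x hx, (hV' x).mp (by rwa [hx]), sub_self]
      rw [← hk b', ← hk b, ← map_div] at e
      rwa [← ratPull_injective π hπ.apply_genericPoint e]
  refine ⟨M, HasDivisor.eq (D := D) ⟨_, hM.pullback π hπ.apply_genericPoint, fun x => ?_⟩ hP⟩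
  rw [hk, hord _ x rfl]

variable [σ.IsOver (Spec (.of ℂ))]

theorem exists_hasDivisor_pullback (hσ : σ ≫ σ = 𝟙 C) (hσ' : σ ≠ 𝟙 C) (hπ : IsQuotient σ π)
    (M : Pic B) : ∃ D, (Pic.pullback π M).HasDivisor D ∧ (∀ x, D (σ x) = D x) ∧
      ∀ r ∈ fixedLocus σ, Even (D r) := by
  have := hπ.isIntegral
  obtain ⟨k, hk⟩ := M.exists_hasEquations
  refine ⟨_, ⟨_, hk.pullback π hπ.apply_genericPoint, fun x => rfl⟩, fun x => ?_, fun r hr => ?_⟩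
  · beta_reduce
    rw [hπ.apply_involution, ← ordAt_ratConj hσ, ratConj_ratPull hσ hπ]
  · exact even_ordAt_of_ratConj_eq hσ hσ' hr (ratConj_ratPull hσ hπ _)

end Descent
/-! ### Divisors supported on the fixed points -/

section Fixed

variable {C : Scheme.{0}} {σ : C ⟶ C} {B : Scheme.{0}} {π : C ⟶ B}

open Classical in
/-- The divisor on `C` with the multiplicities `n` at the fixed points of `σ`. -/
noncomputable def fixedDivisor (n : fixedLocus σ →₀ ℤ) (x : C) : ℤ :=
  if h : x ∈ fixedLocus σ then n ⟨x, h⟩ else 0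

theorem fixedDivisor_apply (n : fixedLocus σ →₀ ℤ) (r : fixedLocus σ) :
    fixedDivisor n r = n r :=
  dif_pos r.2

theorem fixedDivisor_of_notMem (n : fixedLocus σ →₀ ℤ) {x : C} (hx : x ∉ fixedLocus σ) :
    fixedDivisor n x = 0 :=
  dif_neg hx

theorem fixedDivisor_involution (hσ : σ ≫ σ = 𝟙 C) (n : fixedLocus σ →₀ ℤ) (x : C) :
    fixedDivisor n (σ x) = fixedDivisor n x := by
  by_cases hx : x ∈ fixedLocus σ
  · rw [hx.2]
  · rw [fixedDivisor_of_notMem n hx, fixedDivisor_of_notMem]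
    intro h
    have h2 := h.2
    rw [involution_apply hσ] at h2
    exact hx (h2 ▸ h)

variable [C.Over (Spec (.of ℂ))] [IsSmoothProjectiveCurve C]

theorem Pic.HasDivisor.zsmul {P : Pic C} {D : C → ℤ} (hP : P.HasDivisor D) (m : ℤ) :
    (m • P).HasDivisor (m • D) := by
  induction m using Int.induction_on with
  | zero => rw [zero_smul, zero_smul]; exact Pic.hasDivisor_zero
  | succ m ih => rw [add_smul, add_smul, one_smul, one_smul]; exact ih.add hP
  | pred m ih => rw [sub_smul, sub_smul, one_smul, one_smul]; exact ih.sub hP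

theorem hasDivisor_fixedDivisorClass (n : fixedLocus σ →₀ ℤ) :
    (fixedDivisorClass σ n).HasDivisor (fixedDivisor n) := by
  classical
  induction n using Finsupp.induction_linear with
  | zero =>
    have : fixedDivisor (0 : fixedLocus σ →₀ ℤ) = 0 := by
      ext x
      unfold fixedDivisor
      split_ifs <;> rfl
    rw [map_zero, this]
    exact Pic.hasDivisor_zero
  | add n m hn hm =>
    have : fixedDivisor (n + m) = fixedDivisor n + fixedDivisor m := by
      ext x
      rw [Pi.add_apply]
      unfold fixedDivisor
      split_ifs <;> rfl
    rw [map_add, this]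
    exact hn.add hm
  | single r m =>
    have h1 : fixedDivisorClass σ (Finsupp.single r m) =
        m • Pic.mk (pointBundle C r r.2.1) := by
      simp [fixedDivisorClass]
    have h2 : fixedDivisor (Finsupp.single r m) = m • Pi.single (r : C) 1 := by
      ext x
      rw [Pi.smul_apply, smul_eq_mul]
      by_cases hx : x ∈ fixedLocus σ
      · rw [fixedDivisor_apply _ ⟨x, hx⟩, Finsupp.single_apply, Pi.single_apply]
        simp [Subtype.ext_iff, eq_comm]
      · rw [fixedDivisor_of_notMem _ hx, Pi.single_eq_of_ne, mul_zero]
        rintro rfl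
        exact hx r.2
    rw [h1, h2]
    exact (Pic.hasDivisor_pointBundle _ r.2.1).zsmul m

theorem fixedDivisorClass_mem_invariantPic (hσ : σ ≫ σ = 𝟙 C) (n : fixedLocus σ →₀ ℤ) :
    fixedDivisorClass σ n ∈ invariantPic σ := by
  have h := (hasDivisor_fixedDivisorClass n).involution hσ
  simp only [fixedDivisor_involution hσ] at h
  exact h.eq (hasDivisor_fixedDivisorClass n)

/-- Hilbert's theorem 90 for an involution of a curve. -/
theorem exists_mul_ratConj_eq (hσ : σ ≫ σ = 𝟙 C) (hσ' : σ ≠ 𝟙 C) {f : C.functionFieldˣ}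
    (hf : f * ratConj hσ f = 1) : ∃ g, f * ratConj hσ g = g := by
  by_cases h : (1 : C.functionField) + f = 0
  · obtain ⟨w, hw⟩ := exists_ratConj_eq_neg hσ hσ'
    have hf1 : f = -1 := Units.ext (by rw [Units.val_neg, Units.val_one]; linear_combination h)
    exact ⟨w, by rw [hw, hf1, neg_mul_neg, one_mul]⟩
  · refine ⟨Units.mk0 _ h, Units.ext ?_⟩
    have hf' := congrArg Units.val hf
    rw [Units.val_mul, coe_ratConj, Units.val_one] at hf'
    rw [Units.val_mul, coe_ratConj, Units.val_mk0, map_add, map_one]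
    linear_combination hf'

variable [σ.IsOver (Spec (.of ℂ))]

theorem range_pullback_le_invariantPic (hσ : σ ≫ σ = 𝟙 C) (hσ' : σ ≠ 𝟙 C)
    (hπ : IsQuotient σ π) : (Pic.pullback π).range ≤ invariantPic σ := by
  rintro _ ⟨M, rfl⟩
  obtain ⟨D, hD, hinv, -⟩ := exists_hasDivisor_pullback hσ hσ' hπ M
  have h := hD.involution hσ
  simp only [hinv] at h
  exact h.eq hD

/-- The class of a divisor supported on the fixed points is a pullback from the quotient if and
only if all multiplicities have the same parity. -/
theorem fixedDivisorClass_mem_range_iff (hσ : σ ≫ σ = 𝟙 C) (hσ' : σ ≠ 𝟙 C)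
    (hπ : IsQuotient σ π) (n : fixedLocus σ →₀ ℤ) :
    fixedDivisorClass σ n ∈ (Pic.pullback π).range ↔
      (∀ r, Even (n r)) ∨ ∀ r, Odd (n r) := by
  have hn := hasDivisor_fixedDivisorClass n
  constructor
  · rintro ⟨M, hM⟩
    obtain ⟨D, hD, hinv, heven⟩ := exists_hasDivisor_pullback hσ hσ' hπ M
    obtain ⟨f, hf⟩ := (hn.eq_iff hD).mp hM.symm
    obtain ⟨c, hc⟩ := exists_constFun_eq (f := ratConj hσ f / f) fun x => by
      rw [← ordAt_eq_zero, ordAt_div, ordAt_ratConj]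
      have h1 := hf x
      have h2 := hf (σ x)
      rw [fixedDivisor_involution hσ, hinv] at h2
      omega
    have hc1 : ratConj hσ (ratConj hσ f / f) = ratConj hσ f / f :=
      Units.ext (by rw [coe_ratConj, ← hc, funMap_constFun hσ])
    have hcc : (ratConj hσ f / f) * (ratConj hσ f / f) = 1 := by
      nth_rw 1 [← hc1]
      rw [map_div, ratConj_ratConj, div_mul_div_cancel, div_self']
    have hnf : ∀ r : fixedLocus σ, n r = D r + ordAt (r : C) f := fun r => by
      rw [hf, fixedDivisor_apply]
    have hsign : ratConj hσ f / f = 1 ∨ ratConj hσ f / f = -1 := by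
      rw [← Units.val_inj, ← Units.val_inj (b := (-1 : C.functionFieldˣ))]
      apply mul_self_eq_one_iff.mp
      rw [← Units.val_mul, hcc, Units.val_one]
    obtain h | h := hsign
    · left
      intro r
      rw [hnf]
      exact (heven r r.2).add (even_ordAt_of_ratConj_eq hσ hσ' r.2 (div_eq_one.mp h))
    · right
      intro r
      rw [hnf]
      exact (heven r r.2).add_odd (odd_ordAt_of_ratConj_eq_neg hσ hσ' r.2
        (by rw [div_eq_iff_eq_mul.mp h, neg_one_mul]))
  · rintro (h | h)
    · exact hn.mem_range_pullback hσ hπ (fixedDivisor_involution hσ n) fun r hr => by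
        rw [fixedDivisor_apply n ⟨r, hr⟩]
        exact h ⟨r, hr⟩
    · obtain ⟨w, hw⟩ := exists_ratConj_eq_neg hσ hσ'
      refine (hn.add_ordAt w).mem_range_pullback hσ hπ (fun x => ?_) fun r hr => ?_
      · rw [fixedDivisor_involution hσ, ← ordAt_ratConj hσ, hw, ordAt_neg]
      · rw [fixedDivisor_apply n ⟨r, hr⟩]
        exact (h ⟨r, hr⟩).add_odd (odd_ordAt_of_ratConj_eq_neg hσ hσ' hr hw)

theorem exists_sub_fixedDivisorClass_mem (hσ : σ ≫ σ = 𝟙 C) (hσ' : σ ≠ 𝟙 C)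
    (hπ : IsQuotient σ π) {P : Pic C} (hP : P ∈ invariantPic σ) :
    ∃ n : fixedLocus σ →₀ ℤ, P - fixedDivisorClass σ n ∈ (Pic.pullback π).range := by
  obtain ⟨D, hD⟩ := P.exists_hasDivisor
  obtain ⟨f, hf⟩ := ((hD.involution hσ).eq_iff hD).mp hP
  obtain ⟨c, hc⟩ := exists_constFun_eq (f := f * ratConj hσ f) fun x => by
    rw [← ordAt_eq_zero, ordAt_mul, ordAt_ratConj]
    have h1 := hf x
    have h2 := hf (σ x)
    rw [involution_apply hσ] at h2
    omega
  obtain ⟨d, rfl⟩ := IsAlgClosed.exists_eq_mul_self c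
  have hd : constFun C d ≠ 0 := fun h0 => (f * ratConj hσ f).ne_zero
    (by rw [← hc, map_mul, h0, mul_zero])
  set e : C.functionFieldˣ := Units.mk0 _ hd with he
  have hec : ratConj hσ e = e := Units.ext (funMap_constFun hσ d)
  obtain ⟨g, hg⟩ := exists_mul_ratConj_eq hσ hσ' (f := f / e) (by
    rw [map_div, hec, div_mul_div_comm, div_eq_one]
    exact Units.ext (by rw [← hc, map_mul]; rfl))
  have hfe : ∀ x, ordAt x (f / e) = ordAt x f := fun x => by
    rw [ordAt_div, ordAt_eq_zero_of_mem (constFun_mem_unitsAt (f := e) rfl x), sub_zero]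
  have hD' : ∀ x, D (σ x) + ordAt (σ x) g = D x + ordAt x g := fun x => by
    have h1 := congrArg (ordAt x) hg
    rw [ordAt_mul, hfe, ordAt_ratConj] at h1
    have h2 := hf x
    omega
  have := finite_fixedLocus hσ hσ'
  have : Finite (fixedLocus σ) := this
  let n : fixedLocus σ →₀ ℤ :=
    Finsupp.equivFunOnFinite.symm fun r => D r + ordAt (r : C) g
  refine ⟨n, ((hD.add_ordAt g).sub (hasDivisor_fixedDivisorClass n)).mem_range_pullback hσ hπ
    (fun x => ?_) fun r hr => ?_⟩
  · rw [Pi.sub_apply, Pi.sub_apply, hD', fixedDivisor_involution hσ]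
  · rw [Pi.sub_apply, fixedDivisor_apply n ⟨r, hr⟩]
    simp [n]

end Fixed
end CurveInvolution

theorem lemma1 (C : Scheme.{0}) [C.Over (Spec (.of ℂ))] [IsSmoothProjectiveCurve C]
    (σ : C ⟶ C) [σ.IsOver (Spec (.of ℂ))] (hσ : σ ≫ σ = 𝟙 C) (hσ' : σ ≠ 𝟙 C)
    (B : Scheme.{0}) (π : C ⟶ B) (hπ : IsQuotient σ π) :
    Finite (fixedLocus σ) ∧
    (Pic.pullback π).range ≤ invariantPic σ ∧
    ∃ (hinv : ∀ n : fixedLocus σ →₀ ℤ, fixedDivisorClass σ n ∈ invariantPic σ)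
      (φ : (fixedLocus σ → ZMod 2) →+
        invariantPic σ ⧸ (Pic.pullback π).range.addSubgroupOf (invariantPic σ)),
      (∀ n : fixedLocus σ →₀ ℤ,
        φ (fun r => (n r : ZMod 2)) = QuotientAddGroup.mk ⟨fixedDivisorClass σ n, hinv n⟩) ∧
      Function.Surjective φ ∧
      φ.ker = AddSubgroup.zmultiples (fun _ => (1 : ZMod 2)) := by
  have hfin : Finite (fixedLocus σ) := finite_fixedLocus hσ hσ'
  have hinv := fixedDivisorClass_mem_invariantPic hσ
  refine ⟨hfin, range_pullback_le_invariantPic hσ hσ' hπ, hinv, ?_⟩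
  let H := (Pic.pullback π).range.addSubgroupOf (invariantPic σ)
  let red : (fixedLocus σ →₀ ℤ) →+ (fixedLocus σ → ZMod 2) :=
    AddMonoidHom.mk' (fun n r => (n r : ZMod 2)) fun n m => by
      ext r
      simp
  have hred : Function.Surjective red := fun v => by
    choose m hm using fun r => ZMod.intCast_surjective (v r)
    exact ⟨Finsupp.equivFunOnFinite.symm m, funext hm⟩
  let ψ : (fixedLocus σ →₀ ℤ) →+ invariantPic σ ⧸ H :=
    (QuotientAddGroup.mk' H).comp ((fixedDivisorClass σ).codRestrict (invariantPic σ) hinv)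
  have hψ : ∀ n, ψ n = 0 ↔ (∀ r, Even (n r)) ∨ ∀ r, Odd (n r) := fun n => by
    rw [← fixedDivisorClass_mem_range_iff hσ hσ' hπ]
    exact QuotientAddGroup.eq_zero_iff _
  have hker : red.ker ≤ ψ.ker := fun n hn => by
    refine (hψ n).mpr (Or.inl fun r => ?_)
    exact ZMod.intCast_eq_zero_iff_even.mp (congrFun hn r)
  let φ := red.liftOfSurjective hred ⟨ψ, hker⟩
  have hφ : ∀ n, φ (red n) = ψ n := fun n =>
    AddMonoidHom.liftOfRightInverse_comp_apply red _ _ ⟨ψ, hker⟩ n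
  refine ⟨φ, hφ, ?_, ?_⟩
  · intro q
    obtain ⟨⟨P, hP⟩, rfl⟩ := QuotientAddGroup.mk_surjective q
    obtain ⟨n, hn⟩ := exists_sub_fixedDivisorClass_mem hσ hσ' hπ hP
    refine ⟨red n, (hφ n).trans (QuotientAddGroup.eq.mpr ?_)⟩
    rw [neg_add_eq_sub]
    exact hn
  · ext v
    obtain ⟨n, rfl⟩ := hred v
    rw [AddMonoidHom.mem_ker, hφ, hψ, AddSubgroup.mem_zmultiples_iff]
    constructor
    · rintro (h | h)
      · exact ⟨0, funext fun r =>
          (zero_smul ℤ (1 : ZMod 2)).trans (ZMod.intCast_eq_zero_iff_even.mpr (h r)).symm⟩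
      · exact ⟨1, funext fun r =>
          (one_smul ℤ (1 : ZMod 2)).trans (ZMod.intCast_eq_one_iff_odd.mpr (h r)).symm⟩
    · rintro ⟨k, hk⟩
      have hk' : ∀ r, (n r : ZMod 2) = k := fun r =>
        (congrFun hk r).symm.trans (zsmul_one k)
      obtain h | h := Int.even_or_odd k
      · exact Or.inl fun r => ZMod.intCast_eq_zero_iff_even.mp
          ((hk' r).trans (ZMod.intCast_eq_zero_iff_even.mpr h))
      · exact Or.inr fun r => ZMod.intCast_eq_one_iff_odd.mp
          ((hk' r).trans (ZMod.intCast_eq_one_iff_odd.mpr h))
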